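/- **Theorem 2.5.** Write $\mathbb R_+=(0,\infty)$ and let $M_+(\mathbb R_+)$, $M_+(\mathbb R_+^2)$ be the classes of Lebesgue measurable functions with values in $[0,\infty]$ on $\mathbb R_+$ and $\mathbb R_+^2$. For $f\in M_+(\mathbb R_+)$ let $f^*(t)=\inf\{\lambda\ge 0: |\{x\in\mathbb R_+: f(x)>\lambda\}|\le t\}$ (with $\inf\emptyset=\infty$) be its nonincreasing rearrangement. For $K\in M_+(\mathbb R_+^2)$ let $(T_Kf)(x)=\int_0^\infty K(x,y)f(y)\,dy$, and let $L=(K^{*_2})^{*_1}$ be the iterated rearrangement of $K$: first rearrange $y\mapsto K(x,y)$ for each fixed $x$ to get $K^{*_2}(x,s)$, then rearrange $x\mapsto K^{*_2}(x,s)$ for each fixed $s$ to get $L(t,s)$. For $i=1,2$ let $\Phi_i(x)=\int_0^x\phi_i(y)\,dy$ be an $N$-function, where $\phi_i$ is a (strictly) increasing map of $\mathbb R_+$ onto itself, with the conventions $\phi_i(0)=\phi_i^{-1}(0)=0$ and $\phi_i(\infty)=\phi_i^{-1}(\infty)=\Phi_i(\infty)=\infty$; let $u_i\in M_+(\mathbb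 R_+)$ be a weight, i.e. locally integrable on $\mathbb R_+$; and let $$\rho_{\Phi_i,u_i}(f)=\inf\Big\{\lambda>0:\int_0^\infty\Phi_i\big(f(x)/\lambda\big)u_i(x)\,dx\le 1\Big\}\qquad(\inf\emptyset=\infty).$$ Let $\Psi_1(x)=\int_0^x\phi_1^{-1}(y)\,dy$ be the complementary function of $\Phi_1$ and $U_1(x)=\int_0^xu_1$. Suppose that there is $c>0$ such that for all $\lambda,x>0$ $$\phi_1\Big(\frac{c\,\alpha(\lambda,x)}{\lambda}\Big)U_1(x)\le c^{-1}\lambda,\qquad \alpha(\lambda,x)=\int_x^\infty\Psi_1\Big(\frac{\lambda}{U_1(y)}\Big)u_1(y)\,dy,$$ and that there is $c>0$ such that for all $\lambda,x>0$ $$\int_0^x\phi_1^{-1}\Big(\frac{c\,\beta(\lambda,x)}{\lambda}\,\frac{y}{U_1(y)}\Big)\frac{y\,u_1(y)}{U_1(y)}\,dy\le c^{-1}\lambda,\qquad \beta(\lambda,x)=\int_x^\infty\Phi_1\Big(\frac{\lambda}{y}\Big)u_1(y)\,dy$$ (where $0\cdot\infty=0/0=a/\infty=0$, including $a=\infty$,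 and $a/0=\infty$ for $a>0$). If there is a constant $C>0$ with $$\rho_{\Phi_1,u_1}(T_Lf^*)\le C\,\rho_{\Phi_2,u_2}(f^*)\qquad\text{for all } f\in M_+(\mathbb R_+),$$ then there is a constant $C'>0$ with $$\rho_{\Phi_1,u_1}\big((T_Kf)^*\big)\le C'\,\rho_{\Phi_2,u_2}(f^*)\qquad\text{for all } f\in M_+(\mathbb R_+).$$ -/

import Mathlib

open Set MeasureTheory
open scoped ENNReal NNReal

noncomputable section

namespace OrliczLorentz

/-- The class `M₊(ℝ₊)`: nonnegative (possibly infinite) Lebesgue measurable functions on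
`ℝ₊ = (0, ∞)`. Only the values at positive points matter anywhere below. Lebesgue (as opposed to
Borel) measurability is a.e. measurability. -/
def MPos (f : ℝ → ℝ≥0∞) : Prop :=
  AEMeasurable f (volume.restrict (Ioi 0))

/-- The class `M₊(ℝ₊²)`. -/
def MPos₂ (K : ℝ → ℝ → ℝ≥0∞) : Prop :=
  AEMeasurable (fun p : ℝ × ℝ => K p.1 p.2) (volume.restrict (Ioi 0 ×ˢ Ioi 0))

/-- A weight on `ℝ₊`: a locally integrable function in `M₊(ℝ₊)`. -/
structure IsWeight (u : ℝ → ℝ≥0∞) : Prop where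
  mpos : MPos u
  locallyIntegrable : ∀ a b : ℝ, 0 < a → ∫⁻ x in Icc a b, u x < ∞

/-- The distribution function `μ_f(r) = |{x ∈ ℝ₊ : f(x) > r}|`. -/
def distribution (f : ℝ → ℝ≥0∞) (r : ℝ≥0∞) : ℝ≥0∞ :=
  volume {x : ℝ | 0 < x ∧ r < f x}

/-- The nonincreasing rearrangement `f*(t) = inf {r : μ_f(r) ≤ t}`, the generalized inverse of
the distribution function. -/
def rearr (f : ℝ → ℝ≥0∞) (t : ℝ) : ℝ≥0∞ :=
  sInf {r : ℝ≥0∞ | distribution f r ≤ ENNReal.ofReal t}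

/-- The rearrangement `K^{*₂}(x, s)` of `K` in its second variable. -/
def rearrSnd (K : ℝ → ℝ → ℝ≥0∞) (x s : ℝ) : ℝ≥0∞ :=
  rearr (fun y => K x y) s

/-- The rearrangement `K^{*₁}(t, s)` of `K` in its first variable. -/
def rearrFst (K : ℝ → ℝ → ℝ≥0∞) (t s : ℝ) : ℝ≥0∞ :=
  rearr (fun x => K x s) t

/-- The iterated rearrangement `L = (K^{*₂})^{*₁}`. -/
def iteratedRearr (K : ℝ → ℝ → ℝ≥0∞) : ℝ → ℝ → ℝ≥0∞ :=
  rearrFst (rearrSnd K)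

/-- The positive integral operator `(T_K f)(x) = ∫_{ℝ₊} K(x,y) f(y) dy`. -/
def integralOp (K : ℝ → ℝ → ℝ≥0∞) (f : ℝ → ℝ≥0∞) (x : ℝ) : ℝ≥0∞ :=
  ∫⁻ y in Ioi 0, K x y * f y

/-- The `N`-function `Φ(x) = ∫₀ˣ φ(y) dy` with density `φ`. An increasing map `φ` of `ℝ₊` onto
itself is the same thing as an order isomorphism of `[0, ∞]` (it extends uniquely by `φ(0) = 0`,
`φ(∞) = ∞`, and every order isomorphism of `[0, ∞]` arises so). Then `φ.symm` is `φ⁻¹`, and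
`Φ(∞) = ∞`. -/
def nFunction (φ : ℝ≥0∞ ≃o ℝ≥0∞) (x : ℝ≥0∞) : ℝ≥0∞ :=
  ∫⁻ y in {y : ℝ | 0 < y ∧ ENNReal.ofReal y < x}, φ (ENNReal.ofReal y)

/-- The complementary `N`-function `Ψ(x) = ∫₀ˣ φ⁻¹(y) dy`. -/
def complementary (φ : ℝ≥0∞ ≃o ℝ≥0∞) : ℝ≥0∞ → ℝ≥0∞ :=
  nFunction φ.symm

/-- The gauge functional
`ρ_{Φ,u}(f) = inf {r > 0 : ∫_{ℝ₊} Φ(f(x)/r) u(x) dx ≤ 1}` (`r` finite, `inf ∅ = ∞`). -/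
def gauge (φ : ℝ≥0∞ ≃o ℝ≥0∞) (u f : ℝ → ℝ≥0∞) : ℝ≥0∞ :=
  sInf {r : ℝ≥0∞ | 0 < r ∧ r < ∞ ∧ ∫⁻ x in Ioi 0, nFunction φ (f x / r) * u x ≤ 1}

/-- `U(x) = ∫₀ˣ u`. -/
def weightPrimitive (u : ℝ → ℝ≥0∞) (x : ℝ) : ℝ≥0∞ :=
  ∫⁻ y in Ioo 0 x, u y

/-- `α(r, x) = ∫ₓ^∞ Ψ(r / U(y)) u(y) dy`, with `Ψ` complementary to `Φ`. -/
def alpha (φ : ℝ≥0∞ ≃o ℝ≥0∞) (u : ℝ → ℝ≥0∞) (r : ℝ≥0∞) (x : ℝ) : ℝ≥0∞ :=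
  ∫⁻ y in Ioi x, complementary φ (r / weightPrimitive u y) * u y

/-- `β(r, x) = ∫ₓ^∞ Φ(r / y) u(y) dy`. -/
def beta (φ : ℝ≥0∞ ≃o ℝ≥0∞) (u : ℝ → ℝ≥0∞) (r : ℝ≥0∞) (x : ℝ) : ℝ≥0∞ :=
  ∫⁻ y in Ioi x, nFunction φ (r / ENNReal.ofReal y) * u y

/-- For some `c > 0` and all `r, x > 0`: `φ(c α(r,x) / r) U(x) ≤ c⁻¹ r`. -/
def AlphaCondition (φ : ℝ≥0∞ ≃o ℝ≥0∞) (u : ℝ → ℝ≥0∞) : Prop :=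
  ∃ c : ℝ≥0, 0 < c ∧ ∀ (r : ℝ≥0) (x : ℝ), 0 < r → 0 < x →
    φ (c * alpha φ u r x / r) * weightPrimitive u x ≤ (c : ℝ≥0∞)⁻¹ * r

/-- For some `c > 0` and all `r, x > 0`:
`∫₀ˣ φ⁻¹((c β(r,x) / r) (y / U(y))) (y u(y) / U(y)) dy ≤ c⁻¹ r`. -/
def BetaCondition (φ : ℝ≥0∞ ≃o ℝ≥0∞) (u : ℝ → ℝ≥0∞) : Prop :=
  ∃ c : ℝ≥0, 0 < c ∧ ∀ (r : ℝ≥0) (x : ℝ), 0 < r → 0 < x →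
    ∫⁻ y in Ioo 0 x,
        φ.symm (c * beta φ u r x / r * (ENNReal.ofReal y / weightPrimitive u y)) *
          (ENNReal.ofReal y * u y / weightPrimitive u y)
      ≤ (c : ℝ≥0∞)⁻¹ * r

end OrliczLorentz

end

/-! Write ν for the measure u₁ dx on (0, ∞), U(x) = ν(-∞, x), and Pg(x) = x⁻¹ ∫₀ˣ g. Applying
Hardy–Littlewood in y and then in x bounds ∫_E T_K f by the integral of T_L f* over (0, |E|).
Choosing E of measure x inside a superlevel set of T_K f gives (T_K f)* ≤ P(T_L f*)
(`rearr_integralOp_le`). Since L decreases in its first variable, T_L f* is nonincreasing. It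
remains to bound P on nonincreasing functions: ∫ Φ₁(Pg) dν ≤ ∫ Φ₁(Mg) dν
(`exists_lintegral_average_le`), which rescaling turns into a gauge estimate.

A nonincreasing g satisfies g(x) ≤ 2 ∫_{y>x} k/U dν, where k is a dilation of g in the variable U,
up to an additive constant when ν has finite mass. Averaging this by Tonelli bounds Pg by the sum of
two Hardy operators, x⁻¹ ∫_{y<x} k y/U dν and ∫_{y>x} k/U dν. The dilation costs only a factor 2 in
the modular.

Both operators rest on `lintegral_hardy_le`, a dyadic block argument using Young's inequality ab ≤
aφ(a) + bφ⁻¹(b). The β condition feeds it directly for the first operator. The α condition gives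
averaging with respect to ν under the complementary function, and the second operator follows by
duality. No doubling of Φ₁ is assumed: multiplicative constants outside Φ₁ are absorbed into
dilations of its argument. -/

namespace OrliczLorentz

/-! ### Layer-cake formula with a real level parameter. -/

section LayerCake

theorem volume_ofReal_lt (a : ℝ≥0∞) :
    (volume.restrict (Ioi (0 : ℝ))) {t | ENNReal.ofReal t < a} = a := by
  rw [Measure.restrict_apply (measurableSet_lt ENNReal.measurable_ofReal measurable_const)]
  rcases eq_or_ne a ∞ with rfl | ha
  · have : {t : ℝ | ENNReal.ofReal t < ∞} ∩ Ioi 0 = Ioi 0 := by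
      ext t; simp
    rw [this, Real.volume_Ioi]
  · have : {t : ℝ | ENNReal.ofReal t < a} ∩ Ioi 0 = Ioo 0 a.toReal := by
      ext t
      simp only [mem_inter_iff, mem_ofPred_eq, mem_Ioi, mem_Ioo]
      constructor
      · rintro ⟨h, h0⟩
        exact ⟨h0, (ENNReal.ofReal_lt_iff_lt_toReal h0.le ha).1 h⟩
      · rintro ⟨h0, h⟩
        exact ⟨(ENNReal.ofReal_lt_iff_lt_toReal h0.le ha).2 h, h0⟩
    rw [this, Real.volume_Ioo, sub_zero, ENNReal.ofReal_toReal ha]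

/-- Tonelli on the region under the graph of f; infinite values of f need no separate treatment. -/
theorem lintegral_eq_lintegral_meas_ofReal_lt {α : Type*} [MeasurableSpace α] (μ : Measure α)
    [SFinite μ] {f : α → ℝ≥0∞} (hf : Measurable f) :
    ∫⁻ x, f x ∂μ = ∫⁻ r in Ioi (0 : ℝ), μ {x | ENNReal.ofReal r < f x} := by
  have hS : MeasurableSet {p : α × ℝ | ENNReal.ofReal p.2 < f p.1} :=
    measurableSet_lt (ENNReal.measurable_ofReal.comp measurable_snd) (hf.comp measurable_fst)
  have h1 := Measure.prod_apply (μ := μ) (ν := volume.restrict (Ioi (0 : ℝ))) hS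
  have h2 := Measure.prod_apply_symm (μ := μ) (ν := volume.restrict (Ioi (0 : ℝ))) hS
  rw [h1] at h2
  calc ∫⁻ x, f x ∂μ
      = ∫⁻ x, (volume.restrict (Ioi (0 : ℝ))) {r | ENNReal.ofReal r < f x} ∂μ := by
        simp_rw [volume_ofReal_lt]
    _ = _ := h2

end LayerCake

/-! ### Decreasing rearrangements and the Hardy–Littlewood inequality. -/

section Rearrangement

theorem distribution_eq (f : ℝ → ℝ≥0∞) (hf : AEMeasurable f (volume.restrict (Ioi 0)))
    (r : ℝ≥0∞) : distribution f r = (volume.restrict (Ioi 0)) {x | r < f x} := by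
  rw [Measure.restrict_apply₀ (nullMeasurableSet_lt aemeasurable_const hf), distribution]
  congr 1
  ext x
  simp [and_comm]

theorem distribution_congr {f g : ℝ → ℝ≥0∞} (h : f =ᵐ[volume.restrict (Ioi 0)] g) :
    distribution f = distribution g := by
  funext r
  refine measure_congr ?_
  have := (ae_restrict_iff' measurableSet_Ioi).1 h
  filter_upwards [this] with x hx
  refine propext ⟨fun ⟨h0, h1⟩ => ⟨h0, ?_⟩, fun ⟨h0, h1⟩ => ⟨h0, ?_⟩⟩
  · rwa [← hx h0]
  · rwa [hx h0]

theorem rearr_congr {f g : ℝ → ℝ≥0∞} (h : f =ᵐ[volume.restrict (Ioi 0)] g) :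
    rearr f = rearr g := by
  funext t
  simp only [rearr, distribution_congr h]

theorem distribution_antitone (f : ℝ → ℝ≥0∞) : Antitone (distribution f) :=
  fun _ _ h => measure_mono fun _ hx => ⟨hx.1, h.trans_lt hx.2⟩

theorem rearr_antitone (f : ℝ → ℝ≥0∞) : Antitone (rearr f) :=
  fun _ _ h => sInf_le_sInf fun _ hr => hr.trans (ENNReal.ofReal_le_ofReal h)

/-- Right-continuity of the distribution function, by continuity of measure from below along
rational levels. Superlevel sets of the rearrangement thus become explicit initial segments, on
which the measurability and equimeasurability arguments below rely. -/
theorem lt_rearr_iff (f : ℝ → ℝ≥0∞) (t : ℝ) (r : ℝ≥0∞) :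
    r < rearr f t ↔ ENNReal.ofReal t < distribution f r := by
  constructor
  · intro h
    by_contra! hle
    exact absurd (sInf_le hle : rearr f t ≤ r) h.not_ge
  · intro h
    have hU : {x : ℝ | 0 < x ∧ r < f x} =
        ⋃ q ∈ {q : ℚ | r < ENNReal.ofReal q}, {x : ℝ | 0 < x ∧ ENNReal.ofReal q < f x} := by
      ext x
      simp only [mem_ofPred_eq, mem_iUnion, exists_prop]
      constructor
      · rintro ⟨h0, hx⟩
        obtain ⟨q, -, hq1, hq2⟩ := ENNReal.lt_iff_exists_rat_btwn.1 hx
        exact ⟨q, hq1, h0, hq2⟩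
      · rintro ⟨q, hq, h0, hx⟩
        exact ⟨h0, hq.trans hx⟩
    have hdir : DirectedOn (Function.onFun (· ⊆ ·) fun q : ℚ => {x : ℝ | 0 < x ∧ ENNReal.ofReal q < f x})
        {q : ℚ | r < ENNReal.ofReal q} := by
      intro a ha b hb
      refine ⟨min a b, ?_, ?_, ?_⟩
      · rcases min_choice a b with h | h <;> rw [h] <;> assumption
      · exact fun x hx => ⟨hx.1, lt_of_le_of_lt (ENNReal.ofReal_le_ofReal (by simp)) hx.2⟩
      · exact fun x hx => ⟨hx.1, lt_of_le_of_lt (ENNReal.ofReal_le_ofReal (by simp)) hx.2⟩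
    rw [distribution, hU, measure_biUnion_eq_iSup (to_countable _) hdir] at h
    simp only [lt_iSup_iff] at h
    obtain ⟨q, hq, hlt⟩ := h
    refine lt_of_lt_of_le hq (le_sInf fun s hs => ?_)
    by_contra! hsq
    exact absurd (hlt.trans_le ((distribution_antitone f hsq.le).trans hs)) (lt_irrefl _)

theorem measurable_rearr_uncurry {H : ℝ → ℝ → ℝ≥0∞} (hH : Measurable (Function.uncurry H)) :
    Measurable (Function.uncurry fun x s => rearr (H x) s) := by
  refine measurable_of_Ioi fun r => ?_
  have : Function.uncurry (fun x s => rearr (H x) s) ⁻¹' Ioi r =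
      {p : ℝ × ℝ | ENNReal.ofReal p.2 < distribution (H p.1) r} := by
    ext p
    simp only [mem_preimage, mem_Ioi, Function.uncurry, mem_ofPred_eq, lt_rearr_iff]
  rw [this]
  refine measurableSet_lt (ENNReal.measurable_ofReal.comp measurable_snd) ?_
  have hS : MeasurableSet {p : ℝ × ℝ | 0 < p.2 ∧ r < H p.1 p.2} :=
    (measurableSet_lt measurable_const measurable_snd).inter
      (measurableSet_lt measurable_const hH)
  exact (measurable_measure_prodMk_left (ν := volume) hS).comp measurable_fst

/-- The integral over a set is at most the integral of the rearrangement over an initial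
segment of the same measure. -/
theorem setLIntegral_le_rearr {g : ℝ → ℝ≥0∞} (hg : Measurable g) {E : Set ℝ}
    (hE : MeasurableSet E) :
    ∫⁻ x in E, g x ∂(volume.restrict (Ioi 0)) ≤
      ∫⁻ t in {t | ENNReal.ofReal t < (volume.restrict (Ioi (0 : ℝ))) E}, rearr g t
        ∂(volume.restrict (Ioi 0)) := by
  rw [lintegral_eq_lintegral_meas_ofReal_lt _ hg,
    lintegral_eq_lintegral_meas_ofReal_lt _ (rearr_antitone g).measurable]
  refine lintegral_mono fun r => ?_
  have hm : MeasurableSet {t | ENNReal.ofReal t < (volume.restrict (Ioi (0 : ℝ))) E} :=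
    measurableSet_lt ENNReal.measurable_ofReal measurable_const
  rw [Measure.restrict_apply' hE, Measure.restrict_apply' hm]
  have : {x | ENNReal.ofReal r < rearr g x} ∩
      {t | ENNReal.ofReal t < (volume.restrict (Ioi (0 : ℝ))) E} =
      {t | ENNReal.ofReal t < min (distribution g (ENNReal.ofReal r))
        ((volume.restrict (Ioi (0 : ℝ))) E)} := by
    ext t
    simp [lt_rearr_iff]
  rw [this, volume_ofReal_lt, distribution_eq g hg.aemeasurable]
  exact le_min (measure_mono inter_subset_left) (measure_mono inter_subset_right)

/-- The Hardy–Littlewood inequality. -/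
theorem lintegral_mul_le_rearr {f g : ℝ → ℝ≥0∞} (hf : Measurable f) (hg : Measurable g) :
    ∫⁻ x in Ioi 0, g x * f x ≤ ∫⁻ t in Ioi 0, rearr g t * rearr f t := by
  -- Layer cake for f with respect to the measure g dx reduces the product to integrals of g over
  -- superlevel sets of f.
  have key : ∀ {f g : ℝ → ℝ≥0∞}, Measurable f → Measurable g →
      ∫⁻ x in Ioi 0, g x * f x = ∫⁻ r in Ioi (0 : ℝ),
        ∫⁻ x in {x | ENNReal.ofReal r < f x}, g x ∂(volume.restrict (Ioi 0)) := by
    intro f g hf hg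
    have := lintegral_withDensity_eq_lintegral_mul (volume.restrict (Ioi (0 : ℝ))) hg hf
    simp only [Pi.mul_apply] at this
    rw [← this, lintegral_eq_lintegral_meas_ofReal_lt _ hf]
    refine lintegral_congr fun r => ?_
    rw [withDensity_apply _ (measurableSet_lt measurable_const hf)]
  rw [key hf hg, key (rearr_antitone f).measurable (rearr_antitone g).measurable]
  refine lintegral_mono fun r => ?_
  refine (setLIntegral_le_rearr hg (measurableSet_lt measurable_const hf)).trans_eq ?_
  congr 2
  ext t
  rw [mem_ofPred_eq, mem_ofPred_eq, lt_rearr_iff, distribution_eq f hf.aemeasurable]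

end Rearrangement

/-! ### Domination of the rearrangement of T_K f by averages of T_L f*. -/

section IntegralOperator

theorem integralOp_antitone {K : ℝ → ℝ → ℝ≥0∞} (hK : ∀ y, Antitone fun x => K x y)
    (f : ℝ → ℝ≥0∞) : Antitone (integralOp K f) :=
  fun _ _ h => lintegral_mono fun y => by gcongr; exact hK y h

theorem lintegral_integralOp_eq (μ : Measure ℝ) [SFinite μ] {K : ℝ → ℝ → ℝ≥0∞}
    (hK : Measurable (Function.uncurry K)) {f : ℝ → ℝ≥0∞} (hf : Measurable f) :
    ∫⁻ x, integralOp K f x ∂μ = ∫⁻ s in Ioi 0, (∫⁻ x, K x s ∂μ) * f s := by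
  have hm : Measurable (Function.uncurry fun x s => K x s * f s) :=
    hK.mul (hf.comp measurable_snd)
  calc ∫⁻ x, integralOp K f x ∂μ = ∫⁻ s in Ioi 0, ∫⁻ x, K x s * f s ∂μ :=
        lintegral_lintegral_swap hm.aemeasurable
    _ = _ := lintegral_congr fun s => lintegral_mul_const _ (hK.comp measurable_prodMk_right)

theorem measurable_iteratedRearr {K : ℝ → ℝ → ℝ≥0∞} (hK : Measurable (Function.uncurry K)) :
    Measurable (Function.uncurry (iteratedRearr K)) := by
  have hK2 : Measurable (Function.uncurry (rearrSnd K)) := measurable_rearr_uncurry hK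
  have hK3 : Measurable (Function.uncurry fun s x => rearrSnd K x s) := hK2.comp measurable_swap
  have hK4 := measurable_rearr_uncurry (H := fun s x => rearrSnd K x s) hK3
  have heq : Function.uncurry (iteratedRearr K) =
      (Function.uncurry fun s t => rearr (fun x => rearrSnd K x s) t) ∘ Prod.swap := by
    ext ⟨t, s⟩
    rfl
  rw [heq]
  exact hK4.comp measurable_swap

/-- Hardy–Littlewood in y for each fixed x replaces K and f by their rearrangements in y; after
Tonelli, the set version in x for each fixed s replaces E by an initial segment. -/
theorem setLIntegral_integralOp_le {K : ℝ → ℝ → ℝ≥0∞} (hK : Measurable (Function.uncurry K))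
    {f : ℝ → ℝ≥0∞} (hf : Measurable f) {E : Set ℝ} (hE : MeasurableSet E) :
    ∫⁻ x in E, integralOp K f x ∂(volume.restrict (Ioi 0)) ≤
      ∫⁻ t in {t | ENNReal.ofReal t < (volume.restrict (Ioi (0 : ℝ))) E},
        integralOp (iteratedRearr K) (rearr f) t ∂(volume.restrict (Ioi 0)) := by
  have hfr : Measurable (rearr f) := (rearr_antitone f).measurable
  have hK2 : Measurable (Function.uncurry (rearrSnd K)) := measurable_rearr_uncurry hK
  calc ∫⁻ x in E, integralOp K f x ∂(volume.restrict (Ioi 0))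
      ≤ ∫⁻ x in E, integralOp (rearrSnd K) (rearr f) x ∂(volume.restrict (Ioi 0)) :=
        lintegral_mono fun x => lintegral_mul_le_rearr hf (hK.comp measurable_prodMk_left)
    _ ≤ ∫⁻ s in Ioi 0, (∫⁻ t in {t | ENNReal.ofReal t < (volume.restrict (Ioi (0 : ℝ))) E},
          iteratedRearr K t s ∂(volume.restrict (Ioi 0))) * rearr f s := by
        rw [lintegral_integralOp_eq _ hK2 hfr]
        refine lintegral_mono fun s => ?_
        exact mul_le_mul' (setLIntegral_le_rearr (g := fun x => rearrSnd K x s)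
          (hK2.comp measurable_prodMk_right) hE) le_rfl
    _ = _ := (lintegral_integralOp_eq _ (measurable_iteratedRearr hK) hfr).symm

/-- The distribution function of a finite diffuse measure is continuous. -/
theorem continuous_measure_Iio (μ : Measure ℝ) [NullSingletonClass μ]
    (hfin : ∀ x, μ (Iio x) ≠ ∞) : Continuous fun x => μ (Iio x) := by
  refine continuous_iff_continuousAt.2 fun b => ?_
  refine tendsto_measure_of_ae_tendsto_indicator (nhds b) measurableSet_Iio
    (fun _ => measurableSet_Iio) measurableSet_Iio (hfin (b + 1)) ?_ ?_
  · filter_upwards [Iio_mem_nhds (lt_add_one b)] with c hc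
    exact Iio_subset_Iio (le_of_lt hc)
  · have : ∀ᵐ x ∂μ, x ≠ b := by simp [ae_iff]
    filter_upwards [this] with x hx
    rcases lt_or_gt_of_ne hx with h | h
    · filter_upwards [Ioi_mem_nhds h] with c hc
      exact ⟨fun _ => h, fun _ => hc⟩
    · filter_upwards [Iio_mem_nhds h] with c hc
      exact ⟨fun h' => absurd (lt_trans (mem_Iio.1 hc) h') (lt_irrefl _),
        fun h' => absurd (h.trans h') (lt_irrefl _)⟩

/-- Intermediate value theorem for the continuous function b ↦ |S ∩ (0, b)|. -/
theorem exists_measurableSet_subset_volume_eq {S : Set ℝ} (hS : MeasurableSet S) {x : ℝ}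
    (hx : ENNReal.ofReal x < (volume.restrict (Ioi (0 : ℝ))) S) :
    ∃ E ⊆ S, MeasurableSet E ∧ (volume.restrict (Ioi (0 : ℝ))) E = ENNReal.ofReal x := by
  set μ := (volume.restrict (Ioi (0 : ℝ))).restrict S with hμ
  have hfin0 : ∀ b, (volume.restrict (Ioi (0 : ℝ))) (Iio b) ≠ ∞ := fun b => by
    rw [Measure.restrict_apply measurableSet_Iio, inter_comm, Ioi_inter_Iio]
    simp
  have hcont := continuous_measure_Iio μ fun b =>
    ne_top_of_le_ne_top (hfin0 b) (Measure.restrict_apply_le _ _)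
  have hlim : Filter.Tendsto (fun n : ℕ => μ (Iio (n : ℝ))) Filter.atTop (nhds (μ univ)) := by
    have : (⋃ n : ℕ, Iio (n : ℝ)) = univ := by
      ext y
      simpa using exists_nat_gt y
    rw [← this]
    exact tendsto_measure_iUnion_atTop fun a b h => Iio_subset_Iio (by exact_mod_cast h)
  rw [hμ, Measure.restrict_apply_univ] at hlim
  obtain ⟨n, hn⟩ := (hlim.eventually (lt_mem_nhds hx)).exists
  have h0 : μ (Iio 0) = 0 := by
    refine le_antisymm ((Measure.restrict_apply_le _ _).trans ?_) zero_le
    rw [Measure.restrict_apply measurableSet_Iio, inter_comm, Ioi_inter_Iio]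
    simp
  obtain ⟨b, -, hb⟩ := intermediate_value_Icc (f := fun b => μ (Iio b)) (Nat.cast_nonneg n)
    hcont.continuousOn ⟨h0.trans_le zero_le, hn.le⟩
  refine ⟨Iio b ∩ S, inter_subset_right, measurableSet_Iio.inter hS, ?_⟩
  rw [← hb, ← Measure.restrict_apply measurableSet_Iio]

theorem rearr_integralOp_le_of_measurable {K : ℝ → ℝ → ℝ≥0∞}
    (hK : Measurable (Function.uncurry K)) {f : ℝ → ℝ≥0∞} (hf : Measurable f) {x : ℝ}
    (hx : 0 < x) :
    rearr (integralOp K f) x ≤ (ENNReal.ofReal x)⁻¹ *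
      ∫⁻ t in Ioo 0 x, integralOp (iteratedRearr K) (rearr f) t := by
  have hT : Measurable (integralOp K f) :=
    (hK.mul (hf.comp measurable_snd)).lintegral_prod_right'
  refine le_of_forall_lt_imp_le_of_dense fun r hr => ?_
  rw [lt_rearr_iff, distribution_eq _ hT.aemeasurable] at hr
  -- Any r below the rearrangement at x has a superlevel set of measure greater than x. Cutting it
  -- down to measure exactly x gives r x ≤ ∫_E T_K f.
  obtain ⟨E, hES, hE, hEm⟩ := exists_measurableSet_subset_volume_eq
    (measurableSet_lt measurable_const hT) hr
  have h1 := setLIntegral_integralOp_le hK hf hE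
  have h2 : r * ENNReal.ofReal x ≤
      ∫⁻ y in E, integralOp K f y ∂(volume.restrict (Ioi 0)) := by
    rw [← hEm, ← setLIntegral_const]
    exact setLIntegral_mono hT fun y hy => le_of_lt (hES hy)
  have hset : MeasurableSet {t : ℝ | ENNReal.ofReal t < ENNReal.ofReal x} :=
    measurableSet_lt ENNReal.measurable_ofReal measurable_const
  rw [hEm, Measure.restrict_restrict hset] at h1
  have hIoo : {t : ℝ | ENNReal.ofReal t < ENNReal.ofReal x} ∩ Ioi 0 = Ioo 0 x := by
    ext t
    simp only [mem_inter_iff, mem_ofPred_eq, mem_Ioi, mem_Ioo,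
      ENNReal.ofReal_lt_ofReal_iff hx]
    exact and_comm
  rw [hIoo] at h1
  rw [mul_comm, ← div_eq_mul_inv, ENNReal.le_div_iff_mul_le (by simp [hx]) (by simp)]
  exact h2.trans h1

/-- The rearrangement of `T_K f` is dominated by the mean values of `T_L f*`. -/
theorem rearr_integralOp_le {K : ℝ → ℝ → ℝ≥0∞} (hK : MPos₂ K) {f : ℝ → ℝ≥0∞} (hf : MPos f)
    {x : ℝ} (hx : 0 < x) :
    rearr (integralOp K f) x ≤ (ENNReal.ofReal x)⁻¹ *
      ∫⁻ t in Ioo 0 x, integralOp (iteratedRearr K) (rearr f) t := by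
  have hK' : AEMeasurable (fun p : ℝ × ℝ => K p.1 p.2)
      ((volume.restrict (Ioi 0)).prod (volume.restrict (Ioi 0))) := by
    rw [Measure.prod_restrict]
    exact hK
  -- Passing to Borel versions is harmless: for a.e. x the sections of K and G agree a.e., and each
  -- rearrangement ignores null sets.
  set G : ℝ → ℝ → ℝ≥0∞ := fun x y => hK'.mk _ (x, y) with hG
  have hGm : Measurable (Function.uncurry G) := hK'.measurable_mk
  have hKG : ∀ᵐ x ∂(volume.restrict (Ioi (0 : ℝ))), K x =ᵐ[volume.restrict (Ioi 0)] G x :=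
    Measure.ae_ae_of_ae_prod hK'.ae_eq_mk
  have hfg := hf.ae_eq_mk
  have h1 : rearr f = rearr (hf.mk f) := rearr_congr hfg
  have h2 : iteratedRearr K = iteratedRearr G := by
    funext t s
    refine congrFun (rearr_congr ?_) t
    filter_upwards [hKG] with x hx
    exact congrFun (rearr_congr hx) s
  have h3 : rearr (integralOp K f) = rearr (integralOp G (hf.mk f)) := by
    refine rearr_congr ?_
    filter_upwards [hKG] with x hx
    refine lintegral_congr_ae ?_
    filter_upwards [hx, hfg] with y hy hy'
    rw [hy, hy']
  rw [h1, h2, h3]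
  exact rearr_integralOp_le_of_measurable hGm hf.measurable_mk hx

end IntegralOperator

/-! ### N-functions up to dilation, and Young's inequality. -/

section NFunction

theorem nFunction_eq (φ : ℝ≥0∞ ≃o ℝ≥0∞) (x : ℝ≥0∞) :
    nFunction φ x = ∫⁻ y in {y | ENNReal.ofReal y < x}, φ (ENNReal.ofReal y)
      ∂(volume.restrict (Ioi 0)) := by
  rw [Measure.restrict_restrict (measurableSet_lt ENNReal.measurable_ofReal measurable_const)]
  rw [nFunction]
  congr 2
  ext y
  simp [and_comm]

theorem nFunction_mono (φ : ℝ≥0∞ ≃o ℝ≥0∞) : Monotone (nFunction φ) :=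
  fun _ _ h => lintegral_mono_set fun _ hy => ⟨hy.1, hy.2.trans_le h⟩

theorem nFunction_zero (φ : ℝ≥0∞ ≃o ℝ≥0∞) : nFunction φ 0 = 0 := by
  simp [nFunction]

theorem nFunction_iSup (φ : ℝ≥0∞ ≃o ℝ≥0∞) {a : ℕ → ℝ≥0∞} (ha : Monotone a) :
    nFunction φ (⨆ n, a n) = ⨆ n, nFunction φ (a n) := by
  have : {y : ℝ | 0 < y ∧ ENNReal.ofReal y < ⨆ n, a n} =
      ⋃ n, {y : ℝ | 0 < y ∧ ENNReal.ofReal y < a n} := by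
    ext y
    simp [lt_iSup_iff]
  simp only [nFunction, this]
  refine setLIntegral_iUnion_of_directed _ (Monotone.directed_le ?_)
  exact fun m n h y hy => ⟨hy.1, hy.2.trans_le (ha h)⟩

/-- The function `a φ(a)`, which is equivalent to `Φ` up to dilations. -/
noncomputable def growth (φ : ℝ≥0∞ ≃o ℝ≥0∞) (a : ℝ≥0∞) : ℝ≥0∞ := a * φ a

theorem growth_mono (φ : ℝ≥0∞ ≃o ℝ≥0∞) : Monotone (growth φ) :=
  fun _ _ h => mul_le_mul' h (φ.monotone h)

theorem measurable_growth (φ : ℝ≥0∞ ≃o ℝ≥0∞) : Measurable (growth φ) :=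
  (growth_mono φ).measurable

/-- Young's inequality in crude form: either b ≤ φ(a) or a ≤ φ⁻¹(b), so one term suffices. -/
theorem mul_le_growth_add_growth (φ : ℝ≥0∞ ≃o ℝ≥0∞) (a b : ℝ≥0∞) :
    a * b ≤ growth φ a + growth φ.symm b := by
  rcases le_total b (φ a) with h | h
  · exact (mul_le_mul' le_rfl h).trans le_self_add
  · refine le_trans ?_ le_add_self
    rw [mul_comm]
    exact mul_le_mul' le_rfl ((φ.le_symm_apply).2 h)

theorem nFunction_le_growth (φ : ℝ≥0∞ ≃o ℝ≥0∞) (a : ℝ≥0∞) : nFunction φ a ≤ growth φ a := by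
  have hm : MeasurableSet {y | ENNReal.ofReal y < a} :=
    measurableSet_lt ENNReal.measurable_ofReal measurable_const
  rw [nFunction_eq]
  calc _ ≤ ∫⁻ _ in {y | ENNReal.ofReal y < a}, φ a ∂(volume.restrict (Ioi 0)) :=
        setLIntegral_mono measurable_const fun y hy => φ.monotone (le_of_lt hy)
    _ = growth φ a := by rw [setLIntegral_const, volume_ofReal_lt, growth, mul_comm]

theorem growth_le_nFunction (φ : ℝ≥0∞ ≃o ℝ≥0∞) (a : ℝ≥0∞) :
    growth φ a ≤ nFunction φ (2 * a) := by
  have hm : ∀ b, MeasurableSet {y | ENNReal.ofReal y < b} := fun b =>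
    measurableSet_lt ENNReal.measurable_ofReal measurable_const
  have hφm : Measurable fun y : ℝ => φ (ENNReal.ofReal y) :=
    φ.monotone.measurable.comp ENNReal.measurable_ofReal
  -- Only the part of the integral over [b, 2a) is kept, where the density is at least φ(b). Take b
  -- = a when a is finite, and b = 1 when a = ∞, where 2a - a would be useless.
  have key : ∀ b : ℝ≥0∞, b ≠ ∞ → φ b * (2 * a - b) ≤ nFunction φ (2 * a) := by
    intro b hb
    rw [nFunction_eq]
    calc φ b * (2 * a - b)
        ≤ φ b * (volume.restrict (Ioi (0 : ℝ)))
            ({y | ENNReal.ofReal y < 2 * a} \ {y | ENNReal.ofReal y < b}) := by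
          refine mul_le_mul' le_rfl ?_
          refine le_trans ?_ (le_measure_sdiff)
          rw [volume_ofReal_lt, volume_ofReal_lt]
      _ ≤ ∫⁻ y in {y | ENNReal.ofReal y < 2 * a} \ {y | ENNReal.ofReal y < b},
            φ (ENNReal.ofReal y) ∂(volume.restrict (Ioi 0)) := by
          rw [← setLIntegral_const]
          exact setLIntegral_mono hφm fun y hy => φ.monotone (not_lt.1 hy.2)
      _ ≤ _ := lintegral_mono_set sdiff_subset
  rcases eq_or_ne a ∞ with rfl | ha
  · have h1 := key 1 ENNReal.one_ne_top
    have h2 : φ 1 ≠ 0 := by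
      have : φ 1 ≠ φ 0 := fun h => one_ne_zero (φ.injective h)
      rwa [show φ 0 = 0 from φ.map_bot] at this
    rw [ENNReal.mul_top two_ne_zero, ENNReal.top_sub ENNReal.one_ne_top,
      ENNReal.mul_top h2] at h1
    rw [ENNReal.mul_top two_ne_zero]
    exact le_top.trans h1
  · have h1 := key a ha
    rwa [two_mul, ENNReal.add_sub_cancel_right ha, ← two_mul, mul_comm] at h1

/-- Outer constants move inside as dilations, which the gauge sees only as a constant factor. -/
theorem const_mul_nFunction_le (φ : ℝ≥0∞ ≃o ℝ≥0∞) {N : ℝ≥0∞} (hN : 1 ≤ N) (a : ℝ≥0∞) :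
    N * nFunction φ a ≤ nFunction φ (2 * N * a) := by
  calc N * nFunction φ a ≤ N * growth φ a := mul_le_mul' le_rfl (nFunction_le_growth φ a)
    _ = (N * a) * φ a := by rw [growth, mul_assoc]
    _ ≤ growth φ (N * a) :=
        mul_le_mul' le_rfl (φ.monotone (le_mul_of_one_le_left' hN))
    _ ≤ _ := by rw [mul_assoc]; exact growth_le_nFunction φ _

theorem nFunction_add_le (φ : ℝ≥0∞ ≃o ℝ≥0∞) (a b : ℝ≥0∞) :
    nFunction φ (a + b) ≤ nFunction φ (2 * a) + nFunction φ (2 * b) := by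
  rcases le_total a b with h | h
  · exact (nFunction_mono φ (by rw [two_mul]; gcongr)).trans le_add_self
  · exact (nFunction_mono φ (by rw [two_mul]; gcongr)).trans le_self_add

end NFunction

/-! ### A modular Hardy inequality by dyadic decomposition. -/

section Hardy

/-- The distribution function is continuous and increasing, so s is the largest point where it has
not exceeded t. -/
theorem exists_level {μ : Measure ℝ} [NullSingletonClass μ] (h0 : μ (Iic 0) = 0)
    (hfin : ∀ x, μ (Iio x) ≠ ∞) {t : ℝ≥0∞} {x : ℝ} (hx : t < μ (Iio x)) :
    ∃ s, 0 ≤ s ∧ μ (Iio s) = t ∧ ∀ y, μ (Iio y) ≤ t ↔ y ≤ s := by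
  have hcont := continuous_measure_Iio μ hfin
  have hmono : Monotone fun y => μ (Iio y) := fun a b h => measure_mono (Iio_subset_Iio h)
  have hz : μ (Iio 0) = 0 := measure_mono_null Iio_subset_Iic_self h0
  have hx0 : 0 < x := by
    by_contra! h
    have : μ (Iio x) ≤ μ (Iio 0) := hmono h
    rw [hz] at this
    exact absurd (hx.trans_le this) not_lt_zero
  have hcomp : IsCompact (Icc 0 x ∩ {y | μ (Iio y) ≤ t}) :=
    isCompact_Icc.inter_right (isClosed_le hcont continuous_const)
  obtain ⟨s, ⟨hs1, hs2⟩, hs⟩ := hcomp.exists_isGreatest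
    ⟨0, ⟨le_rfl, hx0.le⟩, by simp [hz]⟩
  have hiff : ∀ y, μ (Iio y) ≤ t ↔ y ≤ s := by
    intro y
    refine ⟨fun hy => ?_, fun hy => (hmono hy).trans hs2⟩
    rcases le_total y 0 with h | h
    · exact h.trans hs1.1
    · refine hs ⟨⟨h, ?_⟩, hy⟩
      by_contra! hxy
      exact absurd ((hx.trans_le (hmono hxy.le)).trans_le hy) (lt_irrefl _)
  refine ⟨s, hs1.1, ?_, hiff⟩
  obtain ⟨y, hy, hyt⟩ := intermediate_value_Icc hs1.2 hcont.continuousOn ⟨hs2, hx.le⟩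
  have : y = s := le_antisymm ((hiff y).1 hyt.le) hy.1
  rw [← this]
  exact hyt

/-- A modular inequality for the weighted Hardy operator `k ↦ w(x) ∫_{y < x} k v`, under a
Bloom–Kerman type condition. -/
theorem lintegral_hardy_le (ν : Measure ℝ) [NullSingletonClass ν] (h0 : ν (Iic 0) = 0)
    (φ : ℝ≥0∞ ≃o ℝ≥0∞) {Φ : ℝ≥0∞ → ℝ≥0∞} (hΦ : Monotone Φ) (hΦ0 : Φ 0 = 0)
    {w v k : ℝ → ℝ≥0∞} (hv : Measurable v) (hk : Measurable k)
    {c : ℝ≥0∞} (hc0 : c ≠ 0) (hc : c ≠ ∞)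
    (H : ∀ r : ℝ≥0∞, r ≠ 0 → r ≠ ∞ → ∀ x : ℝ, 0 < x → ∫⁻ y in Ioi x, Φ (r * w y) ∂ν ≠ ∞ ∧
      ∫⁻ y in Iio x, growth φ.symm (c * (∫⁻ y in Ioi x, Φ (r * w y) ∂ν) / r * v y) ∂ν ≤
        ∫⁻ y in Ioi x, Φ (r * w y) ∂ν)
    (hF : ∀ x, ∫⁻ y in Iio x, k y * v y ∂ν ≠ ∞) :
    ∫⁻ x, Φ (w x * ∫⁻ y in Iio x, k y * v y ∂ν) ∂ν ≤ ∫⁻ x, growth φ (8 / c * k x) ∂ν := by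
  set μ := ν.withDensity fun y => k y * v y with hμ
  have hμF : ∀ x, ∫⁻ y in Iio x, k y * v y ∂ν = μ (Iio x) := fun x =>
    (withDensity_apply _ measurableSet_Iio).symm
  simp only [hμF] at hF ⊢
  have hμ0 : μ (Iic 0) = 0 := withDensity_absolutelyContinuous _ _ h0
  have hmono : Monotone fun y => μ (Iio y) := fun a b h => measure_mono (Iio_subset_Iio h)
  -- Write F(x) = μ(Iio x). The output on the block where F lies in (2^j, 2^(j+1)] is controlled by
  -- k on the preceding block, and these blocks are disjoint.
  set E : ℤ → Set ℝ := fun j => {x | μ (Iio x) ∈ Ioc (2 ^ j) (2 ^ (j + 1))} with hE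
  have hEm : ∀ j, MeasurableSet (E j) := fun j => hmono.measurable measurableSet_Ioc
  have hEd : Pairwise (Function.onFun Disjoint E) := by
    have hz : Monotone fun j : ℤ => (2 : ℝ≥0∞) ^ j :=
      fun a b h => ENNReal.zpow_le_of_le (by norm_num) h
    intro i j hij
    exact (hz.pairwise_disjoint_on_Ioc_succ hij).preimage _
  have hstep : ∀ j, ∫⁻ x in E j, Φ (w x * μ (Iio x)) ∂ν ≤
      ∫⁻ x in E (j - 1), growth φ (8 / c * k x) ∂ν := by
    intro j
    rcases (E j).eq_empty_or_nonempty with he | ⟨x, hx⟩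
    · simp [he]
    set p : ℝ≥0∞ := 2 ^ (j - 1) with hp
    have hp0 : p ≠ 0 := (ENNReal.zpow_pos (by norm_num) (by norm_num) _).ne'
    have hpt : p ≠ ∞ := (ENNReal.zpow_lt_top (by norm_num) (by norm_num) _).ne
    have hp1 : (2 : ℝ≥0∞) ^ j = 2 * p := by
      rw [show j = 1 + (j - 1) by ring, ENNReal.zpow_add (by norm_num) (by norm_num), zpow_one]
    have hp2 : (2 : ℝ≥0∞) ^ (j + 1) = 4 * p := by
      rw [add_comm, ENNReal.zpow_add (by norm_num) (by norm_num), zpow_one, hp1, ← mul_assoc]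
      norm_num
    have hxj : 2 * p < μ (Iio x) := hp1 ▸ hx.1
    have hpp : p ≤ 2 * p := by rw [two_mul]; exact le_self_add
    obtain ⟨s, hs0, hs, hsiff⟩ := exists_level hμ0 hF hxj
    obtain ⟨s', -, hs', hsiff'⟩ := exists_level hμ0 hF (hpp.trans_lt hxj)
    have hspos : 0 < s := by
      refine lt_of_le_of_ne hs0 fun h => ?_
      rw [← h, measure_mono_null Iio_subset_Iic_self hμ0] at hs
      exact hp0 (by simpa using hs.symm)
    -- With p = 2^(j-1), the level 4p is the upper bound of F on block j, and s, where F = 2p,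
    -- separates the two blocks.
    obtain ⟨hβt, hβ⟩ := H (4 * p) (mul_ne_zero (by norm_num) hp0)
      (ENNReal.mul_ne_top (by norm_num) hpt) s hspos
    set β := ∫⁻ y in Ioi s, Φ (4 * p * w y) ∂ν with hβdef
    have hleft : ∫⁻ x in E j, Φ (w x * μ (Iio x)) ∂ν ≤ β := by
      calc ∫⁻ x in E j, Φ (w x * μ (Iio x)) ∂ν ≤ ∫⁻ x in E j, Φ (4 * p * w x) ∂ν := by
            refine setLIntegral_mono' (hEm j) fun y hy => hΦ ?_
            rw [mul_comm, ← hp2]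
            exact mul_le_mul' hy.2 le_rfl
        _ ≤ β := by
            refine lintegral_mono_set fun y hy => ?_
            by_contra! hys
            exact absurd (((hsiff y).2 (not_lt.1 hys)).trans_lt (hp1 ▸ hy.1)) (lt_irrefl _)
    have hE1 : E (j - 1) = {y | p < μ (Iio y) ∧ μ (Iio y) ≤ 2 * p} := by
      rw [hE, ← hp1]
      simp only [sub_add_cancel]
      rfl
    have hblock : p ≤ μ (E (j - 1)) := by
      have h1 : Iio s ⊆ Iic s' ∪ E (j - 1) := by
        intro y hy
        rcases le_or_gt y s' with h | h
        · exact Or.inl h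
        · right
          rw [hE1]
          refine ⟨?_, (hsiff y).2 (le_of_lt hy)⟩
          by_contra! h'
          exact absurd h ((hsiff' y).1 h').not_gt
      have h2 : μ (Iio s) ≤ μ (Iic s') + μ (E (j - 1)) :=
        (measure_mono h1).trans (measure_union_le _ _)
      rw [hs, ← measure_congr (Iio_ae_eq_Iic (μ := μ)), hs', two_mul] at h2
      exact ENNReal.le_of_add_le_add_left hpt h2
    have hright : ∫⁻ y in E (j - 1), growth φ.symm (c * β / (4 * p) * v y) ∂ν ≤ β := by
      refine le_trans ?_ hβ
      rw [setLIntegral_congr (Iio_ae_eq_Iic (μ := ν) (a := s))]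
      refine lintegral_mono_set fun y hy => ?_
      rw [hE1] at hy
      exact (hsiff y).1 hy.2
    -- The preceding block has μ-mass at least p. In 8/c, a factor 4 cancels the 4p in H, and a
    -- factor 2 makes the left side 2β, so that the β returned by Young can be subtracted, β being
    -- finite.
    have hyoung : 2 * β ≤ ∫⁻ y in E (j - 1), growth φ (8 / c * k y) ∂ν + β := by
      calc 2 * β ≤ (8 / c * (c * β / (4 * p))) * μ (E (j - 1)) := by
            have : 8 / c * (c * β / (4 * p)) * p = 2 * β := by
              rw [div_eq_mul_inv, div_eq_mul_inv, ENNReal.mul_inv (by simp) (by simp)]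
              calc 8 * c⁻¹ * (c * β * (4⁻¹ * p⁻¹)) * p
                  = (c * c⁻¹) * (p * p⁻¹) * (8 * 4⁻¹) * β := by ring
                _ = 2 * β := by
                  rw [ENNReal.mul_inv_cancel hc0 hc, ENNReal.mul_inv_cancel hp0 hpt]
                  rw [show (8 : ℝ≥0∞) = 2 * 4 by norm_num, mul_assoc 2,
                    ENNReal.mul_inv_cancel (by norm_num) (by norm_num)]
                  ring
            rw [← this]
            exact mul_le_mul' le_rfl hblock
        _ = ∫⁻ y in E (j - 1), (8 / c * k y) * (c * β / (4 * p) * v y) ∂ν := by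
            rw [hμ, withDensity_apply _ (hEm _), ← lintegral_const_mul (f := fun y => k y * v y) _ (hk.mul hv)]
            refine lintegral_congr fun y => ?_
            ring
        _ ≤ ∫⁻ y in E (j - 1), (growth φ (8 / c * k y) +
              growth φ.symm (c * β / (4 * p) * v y)) ∂ν :=
            lintegral_mono fun y => mul_le_growth_add_growth φ _ _
        _ ≤ _ := by
            rw [lintegral_add_left (f := fun y => growth φ (8 / c * k y))
              ((measurable_growth φ).comp (hk.const_mul _))]
            gcongr
    rw [two_mul] at hyoung
    exact hleft.trans (ENNReal.le_of_add_le_add_right hβt hyoung)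
  have hsupp : (Function.support fun x => Φ (w x * μ (Iio x))) ⊆ ⋃ j, E j := by
    intro x hx
    have : μ (Iio x) ≠ 0 := fun h => hx (by simp [h, hΦ0])
    obtain ⟨j, hj⟩ := ENNReal.exists_mem_Ioc_zpow (y := 2) this (hF x) (by norm_num) (by norm_num)
    exact mem_iUnion.2 ⟨j, hj⟩
  calc ∫⁻ x, Φ (w x * μ (Iio x)) ∂ν
      = ∫⁻ x in ⋃ j, E j, Φ (w x * μ (Iio x)) ∂ν := by
        rw [← lintegral_indicator (MeasurableSet.iUnion hEm), indicator_eq_self.2 hsupp]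
    _ = ∑' j, ∫⁻ x in E j, Φ (w x * μ (Iio x)) ∂ν := lintegral_iUnion hEm hEd _
    _ ≤ ∑' j, ∫⁻ x in E (j - 1), growth φ (8 / c * k x) ∂ν := ENNReal.tsum_le_tsum hstep
    _ = ∑' j, ∫⁻ x in E j, growth φ (8 / c * k x) ∂ν :=
        (Equiv.subRight (1 : ℤ)).tsum_eq fun j => ∫⁻ x in E j, growth φ (8 / c * k x) ∂ν
    _ = ∫⁻ x in ⋃ j, E j, growth φ (8 / c * k x) ∂ν := (lintegral_iUnion hEm hEd _).symm
    _ ≤ _ := setLIntegral_le_lintegral _ _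

end Hardy

/-! ### The two Hardy operators: the lower from β, the upper from α by duality. -/

section Averaging

theorem lintegral_lintegral_Ioi_mul {ν : Measure ℝ} [SFinite ν] {a f : ℝ → ℝ≥0∞} (ha : Measurable a)
    (hf : Measurable f) (μ : Measure ℝ) [SFinite μ] :
    ∫⁻ x, (∫⁻ y in Ioi x, a y ∂ν) * f x ∂μ = ∫⁻ y, a y * ∫⁻ x in Iio y, f x ∂μ ∂ν := by
  have hm : Measurable (Function.uncurry fun x y : ℝ =>
      ({p : ℝ × ℝ | p.1 < p.2}.indicator (fun p => a p.2 * f p.1) (x, y))) :=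
    ((ha.comp measurable_snd).mul (hf.comp measurable_fst)).indicator
      (measurableSet_lt measurable_fst measurable_snd)
  calc ∫⁻ x, (∫⁻ y in Ioi x, a y ∂ν) * f x ∂μ
      = ∫⁻ x, ∫⁻ y, ({p : ℝ × ℝ | p.1 < p.2}.indicator (fun p => a p.2 * f p.1) (x, y)) ∂ν ∂μ := by
        refine lintegral_congr fun x => ?_
        rw [← lintegral_mul_const _ ha, ← lintegral_indicator measurableSet_Ioi]
        rfl
    _ = ∫⁻ y, ∫⁻ x, ({p : ℝ × ℝ | p.1 < p.2}.indicator (fun p => a p.2 * f p.1) (x, y)) ∂μ ∂ν :=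
        lintegral_lintegral_swap hm.aemeasurable
    _ = _ := by
        refine lintegral_congr fun y => ?_
        rw [← lintegral_const_mul _ hf, ← lintegral_indicator measurableSet_Iio]
        rfl

variable {ν : Measure ℝ} [NullSingletonClass ν] {φ : ℝ≥0∞ ≃o ℝ≥0∞}

theorem measurable_measure_Iio (ν : Measure ℝ) : Measurable fun x => ν (Iio x) :=
  Monotone.measurable fun _ _ h => measure_mono (Iio_subset_Iio h)

/-- The `β` condition gives the modular inequality for the Hardy operator
`k ↦ x⁻¹ ∫_{y < x} k(y) y / U(y)`. -/
theorem lintegral_nFunction_lower_le (h0 : ν (Iic 0) = 0) (hfin : ∀ x, ν (Iio x) ≠ ∞)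
    (hpos : ∀ x, 0 < x → ν (Iio x) ≠ 0) {c : ℝ≥0∞} (hc0 : c ≠ 0) (hc : c ≠ ∞)
    (hβ : ∀ r : ℝ≥0∞, r ≠ 0 → r ≠ ∞ → ∀ x : ℝ, 0 < x →
      ∫⁻ y in Iio x, φ.symm (c * (∫⁻ z in Ioi x, nFunction φ (r / ENNReal.ofReal z) ∂ν) / r *
        (ENNReal.ofReal y / ν (Iio y))) * (ENNReal.ofReal y / ν (Iio y)) ∂ν ≤ c⁻¹ * r)
    {k : ℝ → ℝ≥0∞} (hk : Measurable k)
    (hF : ∀ x, ∫⁻ y in Iio x, k y * (ENNReal.ofReal y / ν (Iio y)) ∂ν ≠ ∞) :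
    ∫⁻ x, nFunction φ ((ENNReal.ofReal x)⁻¹ *
        ∫⁻ y in Iio x, k y * (ENNReal.ofReal y / ν (Iio y)) ∂ν) ∂ν ≤
      ∫⁻ x, growth φ (8 / c * k x) ∂ν := by
  refine lintegral_hardy_le ν h0 φ (nFunction_mono φ) (nFunction_zero φ)
    (w := fun x => (ENNReal.ofReal x)⁻¹)
    (ENNReal.measurable_ofReal.div (measurable_measure_Iio ν)) hk hc0 hc ?_ hF
  intro r hr0 hr x hx
  have hb := hβ r hr0 hr x hx
  simp only [div_eq_mul_inv r] at hb
  have hcr : c⁻¹ * r ≠ ∞ := ENNReal.mul_ne_top (ENNReal.inv_ne_top.2 hc0) hr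
  set B := ∫⁻ z in Ioi x, nFunction φ (r * (ENNReal.ofReal z)⁻¹) ∂ν with hB
  -- An infinite B would make the integrand of the β condition infinite on (0, x), a set of positive
  -- ν-measure.
  have hBt : B ≠ ∞ := by
    intro hBtop
    rw [hBtop, ENNReal.mul_top hc0, ENNReal.top_div_of_ne_top hr] at hb
    have h1 : ∀ y ∈ Ioo 0 x, φ.symm (∞ * (ENNReal.ofReal y / ν (Iio y))) *
        (ENNReal.ofReal y / ν (Iio y)) = ∞ := by
      intro y hy
      have hne : ENNReal.ofReal y / ν (Iio y) ≠ 0 :=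
        ENNReal.div_ne_zero.2 ⟨by simpa using hy.1, hfin y⟩
      rw [ENNReal.top_mul hne, show φ.symm ∞ = ∞ from φ.symm.map_top, ENNReal.top_mul hne]
    have h2 : ν (Ioo 0 x) ≠ 0 := by
      intro h
      refine hpos x hx (measure_mono_null (t := Iic 0 ∪ Ioo 0 x) ?_ (measure_union_null h0 h))
      intro y hy
      rcases le_or_gt y 0 with h' | h'
      · exact Or.inl h'
      · exact Or.inr ⟨h', hy⟩
    have h3 := (lintegral_mono_set (μ := ν) (f := fun y => φ.symm (∞ * (ENNReal.ofReal y /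
      ν (Iio y))) * (ENNReal.ofReal y / ν (Iio y))) (Ioo_subset_Iio_self (a := 0) (b := x))).trans hb
    rw [setLIntegral_congr_fun measurableSet_Ioo h1, setLIntegral_const, ENNReal.top_mul h2] at h3
    exact hcr (top_le_iff.1 h3)
  refine ⟨hBt, ?_⟩
  have hcB : c * B / r ≠ ∞ := ENNReal.div_ne_top (ENNReal.mul_ne_top hc hBt) hr0
  calc ∫⁻ y in Iio x, growth φ.symm (c * B / r * (ENNReal.ofReal y / ν (Iio y))) ∂ν
      = c * B / r * ∫⁻ y in Iio x, φ.symm (c * B / r * (ENNReal.ofReal y / ν (Iio y))) *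
          (ENNReal.ofReal y / ν (Iio y)) ∂ν := by
        rw [← lintegral_const_mul' _ _ hcB]
        refine lintegral_congr fun y => ?_
        rw [growth]
        ring
    _ ≤ c * B / r * (c⁻¹ * r) := mul_le_mul' le_rfl hb
    _ = (c * c⁻¹) * (r * r⁻¹) * B := by rw [div_eq_mul_inv]; ring
    _ = B := by rw [ENNReal.mul_inv_cancel hc0 hc, ENNReal.mul_inv_cancel hr0 hr, one_mul, one_mul]

/-- The `α` condition gives the modular inequality for averaging with respect to `ν`, in the
complementary space. -/
theorem lintegral_complementary_average_le (h0 : ν (Iic 0) = 0)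
    (hpos : ∀ x, 0 < x → ν (Iio x) ≠ 0) {c : ℝ≥0∞} (hc0 : c ≠ 0) (hc : c ≠ ∞)
    (hα : ∀ r : ℝ≥0∞, r ≠ 0 → r ≠ ∞ → ∀ x : ℝ, 0 < x →
      φ (c * (∫⁻ y in Ioi x, nFunction φ.symm (r / ν (Iio y)) ∂ν) / r) * ν (Iio x) ≤ c⁻¹ * r)
    {f : ℝ → ℝ≥0∞} (hf : Measurable f) (hF : ∀ x, ∫⁻ y in Iio x, f y ∂ν ≠ ∞) :
    ∫⁻ x, nFunction φ.symm ((ν (Iio x))⁻¹ * ∫⁻ y in Iio x, f y ∂ν) ∂ν ≤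
      ∫⁻ x, growth φ.symm (8 / c * f x) ∂ν := by
  have := lintegral_hardy_le ν h0 φ.symm (nFunction_mono φ.symm) (nFunction_zero φ.symm)
    (w := fun x => (ν (Iio x))⁻¹) (v := fun _ => 1) measurable_const hf hc0 hc ?_
    (by simpa using hF)
  · simpa using this
  intro r hr0 hr x hx
  have ha := hα r hr0 hr x hx
  simp only [div_eq_mul_inv r] at ha
  have hcr : c⁻¹ * r ≠ ∞ := ENNReal.mul_ne_top (ENNReal.inv_ne_top.2 hc0) hr
  set A := ∫⁻ z in Ioi x, nFunction φ.symm (r * (ν (Iio z))⁻¹) ∂ν with hA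
  have hAt : A ≠ ∞ := by
    intro h
    rw [h, ENNReal.mul_top hc0, ENNReal.top_div_of_ne_top hr, show φ ∞ = ∞ from φ.map_top,
      ENNReal.top_mul (hpos x hx)] at ha
    exact hcr (top_le_iff.1 ha)
  refine ⟨hAt, ?_⟩
  rw [setLIntegral_const, mul_one, growth, mul_assoc]
  calc c * A / r * (φ (c * A / r) * ν (Iio x)) ≤ c * A / r * (c⁻¹ * r) := mul_le_mul' le_rfl ha
    _ = (c * c⁻¹) * (r * r⁻¹) * A := by rw [div_eq_mul_inv]; ring
    _ = A := by rw [ENNReal.mul_inv_cancel hc0 hc, ENNReal.mul_inv_cancel hr0 hr, one_mul, one_mul]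

/-- The modular inequality for `k ↦ ∫_{y > x} k / U`, dual to averaging with respect to `ν`. -/
theorem lintegral_growth_upper_le [SFinite ν] (h0 : ν (Iic 0) = 0) (hfin : ∀ x, ν (Iio x) ≠ ∞)
    (hpos : ∀ x, 0 < x → ν (Iio x) ≠ 0) {c : ℝ≥0∞} (hc0 : c ≠ 0) (hc : c ≠ ∞)
    (hα : ∀ r : ℝ≥0∞, r ≠ 0 → r ≠ ∞ → ∀ x : ℝ, 0 < x →
      φ (c * (∫⁻ y in Ioi x, nFunction φ.symm (r / ν (Iio y)) ∂ν) / r) * ν (Iio x) ≤ c⁻¹ * r)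
    {k : ℝ → ℝ≥0∞} (hk : Measurable k) {B : ℝ≥0∞} (hB : B ≠ ∞)
    (hkB : ∀ x, ∫⁻ y in Ioi x, k y * (ν (Iio y))⁻¹ ∂ν ≤ B) {b : ℝ}
    (hkb : ∀ x, b ≤ x → ∫⁻ y in Ioi x, k y * (ν (Iio y))⁻¹ ∂ν = 0) :
    ∫⁻ x, growth φ (∫⁻ y in Ioi x, k y * (ν (Iio y))⁻¹ ∂ν) ∂ν ≤
      2 * ∫⁻ x, growth φ (32 / c * k x) ∂ν := by
  set h : ℝ → ℝ≥0∞ := fun x => ∫⁻ y in Ioi x, k y * (ν (Iio y))⁻¹ ∂ν with hh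
  have hhm : Measurable h :=
    Antitone.measurable fun _ _ hxy => lintegral_mono_set (Ioi_subset_Ioi hxy)
  have hfm : Measurable fun x => φ (h x) := φ.monotone.measurable.comp hhm
  have hφB : φ B ≠ ∞ := fun hφ => hB (φ.injective (hφ.trans φ.map_top.symm))
  set I := ∫⁻ x, growth φ (h x) ∂ν with hI
  -- Finiteness allows I/2 to be subtracted at the end; this is why h is assumed bounded and zero
  -- beyond b.
  have hIt : I ≠ ∞ := by
    have h1 : ∀ x, growth φ (h x) ≤ (Iio b).indicator (fun _ => growth φ B) x := by
      intro x
      rcases lt_or_ge x b with hx | hx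
      · rw [indicator_of_mem (mem_Iio.2 hx)]
        exact growth_mono φ (hkB x)
      · rw [show h x = 0 from hkb x hx, growth, zero_mul]
        exact zero_le
    refine ne_top_of_le_ne_top ?_ (lintegral_mono h1)
    rw [lintegral_indicator measurableSet_Iio, setLIntegral_const]
    exact ENNReal.mul_ne_top (ENNReal.mul_ne_top hB hφB) (hfin b)
  -- Chosen so that 8/c · D = 1/2, which makes the averaged term at most I/2, and so that 2 · c/32 =
  -- D, the 2 being the dilation from `growth_le_nFunction`.
  set D : ℝ≥0∞ := c / 16 with hD
  have hDt : D ≠ ∞ := ENNReal.div_ne_top hc (by norm_num)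
  have hav := lintegral_complementary_average_le h0 hpos hc0 hc hα (f := fun x => D * φ (h x))
    (hfm.const_mul D) (fun x => by
      rw [lintegral_const_mul _ hfm]
      refine ENNReal.mul_ne_top hDt (ne_top_of_le_ne_top ?_
        (lintegral_mono fun y => φ.monotone (hkB y)))
      rw [setLIntegral_const]
      exact ENNReal.mul_ne_top hφB (hfin x))
  have hcc : c * c⁻¹ = 1 := ENNReal.mul_inv_cancel hc0 hc
  have h16 : (16 : ℝ≥0∞) * 16⁻¹ = 1 := ENNReal.mul_inv_cancel (by norm_num) (by norm_num)
  have h2 : (2 : ℝ≥0∞) * 2⁻¹ = 1 := ENNReal.mul_inv_cancel (by norm_num) (by norm_num)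
  have hinv : (16 : ℝ≥0∞)⁻¹ * 8 = 2⁻¹ := by
    calc (16 : ℝ≥0∞)⁻¹ * 8 = 16⁻¹ * 8 * (2 * 2⁻¹) := by rw [h2, mul_one]
      _ = (16 * 16⁻¹) * 2⁻¹ := by ring
      _ = _ := by rw [h16, one_mul]
  have hhalf : ∫⁻ x, growth φ.symm (8 / c * (D * φ (h x))) ∂ν ≤ 2⁻¹ * I := by
    have hgm : Measurable fun x => growth φ (h x) := (measurable_growth φ).comp hhm
    rw [hI, ← lintegral_const_mul _ hgm]
    refine lintegral_mono fun x => ?_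
    have e : 8 / c * (D * φ (h x)) = 2⁻¹ * φ (h x) := by
      rw [hD, div_eq_mul_inv, div_eq_mul_inv]
      calc 8 * c⁻¹ * (c * 16⁻¹ * φ (h x)) = (c * c⁻¹) * (16⁻¹ * 8) * φ (h x) := by ring
        _ = _ := by rw [hcc, hinv, one_mul]
    rw [e, growth, mul_assoc]
    refine mul_le_mul' le_rfl ?_
    rw [growth, mul_comm]
    refine mul_le_mul' ?_ le_rfl
    rw [OrderIso.symm_apply_le]
    exact mul_le_of_le_one_left' (by simp)
  have hkU : Measurable fun y => k y * (ν (Iio y))⁻¹ := hk.mul (measurable_measure_Iio ν).inv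
  -- Duality: Tonelli turns the pairing of the upper operator of k with φ(h) into k paired with the
  -- ν-average of φ(h).
  have hfubini : I = ∫⁻ y, (32 / c * k y) * (c / 32 * ((ν (Iio y))⁻¹ *
      ∫⁻ x in Iio y, φ (h x) ∂ν)) ∂ν := by
    rw [hI]
    simp only [growth]
    rw [hh, lintegral_lintegral_Ioi_mul hkU hfm ν]
    refine lintegral_congr fun y => ?_
    have h32 : (32 : ℝ≥0∞) * 32⁻¹ = 1 := ENNReal.mul_inv_cancel (by norm_num) (by norm_num)
    rw [div_eq_mul_inv, div_eq_mul_inv]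
    calc _ = (c * c⁻¹) * (32 * 32⁻¹) * (k y * (ν (Iio y))⁻¹ * ∫⁻ x in Iio y, φ (h x) ∂ν) := by
          rw [hcc, h32, one_mul, one_mul]
      _ = _ := by ring
  have hmain : I ≤ ∫⁻ x, growth φ (32 / c * k x) ∂ν + 2⁻¹ * I := by
    calc I ≤ ∫⁻ y, (growth φ (32 / c * k y) + growth φ.symm (c / 32 * ((ν (Iio y))⁻¹ *
          ∫⁻ x in Iio y, φ (h x) ∂ν))) ∂ν :=
          hfubini.trans_le (lintegral_mono fun y => mul_le_growth_add_growth φ _ _)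
      _ = ∫⁻ y, growth φ (32 / c * k y) ∂ν + ∫⁻ y, growth φ.symm (c / 32 * ((ν (Iio y))⁻¹ *
          ∫⁻ x in Iio y, φ (h x) ∂ν)) ∂ν :=
          lintegral_add_left ((measurable_growth φ).comp (hk.const_mul _)) _
      _ ≤ _ := by
          refine add_le_add le_rfl (le_trans (lintegral_mono fun y => ?_) (hav.trans hhalf))
          refine (growth_le_nFunction φ.symm _).trans (le_of_eq ?_)
          congr 1
          rw [lintegral_const_mul _ hfm, hD]
          have : (2 : ℝ≥0∞) * (c / 32) = c / 16 := by
            rw [div_eq_mul_inv, div_eq_mul_inv, show (32 : ℝ≥0∞) = 2 * 16 by norm_num,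
              ENNReal.mul_inv (by simp) (by simp)]
            calc 2 * (c * (2⁻¹ * 16⁻¹)) = (2 * 2⁻¹) * (c * 16⁻¹) := by ring
              _ = _ := by rw [h2, one_mul]
          rw [← mul_assoc, this]
          ring
  have hsplit : I = 2⁻¹ * I + 2⁻¹ * I := by
    rw [← add_mul, ENNReal.inv_two_add_inv_two, one_mul]
  have hle : 2⁻¹ * I ≤ ∫⁻ x, growth φ (32 / c * k x) ∂ν := by
    refine ENNReal.le_of_add_le_add_right (a := 2⁻¹ * I) (ENNReal.mul_ne_top (by norm_num) hIt) ?_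
    rw [← hsplit]
    exact hmain
  calc I = 2 * (2⁻¹ * I) := by rw [← mul_assoc, h2, one_mul]
    _ ≤ _ := mul_le_mul' le_rfl hle

end Averaging

/-! ### The sum of the two operators, by truncation and monotone convergence. -/

section HardySum

/-- The sum of the two Hardy operators associated with a measure `ν` on `ℝ₊`. -/
noncomputable def hardySum (ν : Measure ℝ) (k : ℝ → ℝ≥0∞) (x : ℝ) : ℝ≥0∞ :=
  (ENNReal.ofReal x)⁻¹ * ∫⁻ y in Iio x, k y * (ENNReal.ofReal y / ν (Iio y)) ∂ν +
    ∫⁻ y in Ioi x, k y * (ν (Iio y))⁻¹ ∂ν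

theorem measurable_hardySum (ν : Measure ℝ) (k : ℝ → ℝ≥0∞) : Measurable (hardySum ν k) := by
  refine (ENNReal.measurable_ofReal.inv.mul (Monotone.measurable ?_)).add (Antitone.measurable ?_)
  · exact fun _ _ h => lintegral_mono_set (Iio_subset_Iio h)
  · exact fun _ _ h => lintegral_mono_set (Ioi_subset_Ioi h)

theorem hardySum_const_mul (ν : Measure ℝ) {k : ℝ → ℝ≥0∞} (hk : Measurable k) (c : ℝ≥0∞)
    (x : ℝ) :
    hardySum ν (fun y => c * k y) x = c * hardySum ν k x := by
  have h1 : Measurable fun y => k y * (ENNReal.ofReal y / ν (Iio y)) :=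
    hk.mul (ENNReal.measurable_ofReal.div (measurable_measure_Iio ν))
  have h2 : Measurable fun y => k y * (ν (Iio y))⁻¹ := hk.mul (measurable_measure_Iio ν).inv
  simp only [hardySum, mul_assoc c]
  rw [lintegral_const_mul _ h1, lintegral_const_mul _ h2]
  ring

theorem hardySum_mono (ν : Measure ℝ) {k k' : ℝ → ℝ≥0∞} (h : k ≤ k') :
    hardySum ν k ≤ hardySum ν k' := fun _ =>
  add_le_add (mul_le_mul' le_rfl (lintegral_mono fun y => mul_le_mul' (h y) le_rfl))
    (lintegral_mono fun y => mul_le_mul' (h y) le_rfl)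

theorem hardySum_iSup (ν : Measure ℝ) {k : ℕ → ℝ → ℝ≥0∞} (hk : ∀ n, Measurable (k n))
    (hmono : Monotone k) (x : ℝ) :
    hardySum ν (fun y => ⨆ n, k n y) x = ⨆ n, hardySum ν (k n) x := by
  have h1 : ∀ n, Measurable fun y => k n y * (ENNReal.ofReal y / ν (Iio y)) := fun n =>
    (hk n).mul (ENNReal.measurable_ofReal.div (measurable_measure_Iio ν))
  have h2 : ∀ n, Measurable fun y => k n y * (ν (Iio y))⁻¹ := fun n =>
    (hk n).mul (measurable_measure_Iio ν).inv
  simp only [hardySum, ENNReal.iSup_mul]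
  rw [lintegral_iSup h1 fun m n h y => mul_le_mul' (hmono h y) le_rfl,
    lintegral_iSup h2 fun m n h y => mul_le_mul' (hmono h y) le_rfl, ENNReal.mul_iSup,
    ENNReal.iSup_add_iSup_of_monotone]
  · exact fun m n h => mul_le_mul' le_rfl
      (lintegral_mono fun y => mul_le_mul' (hmono h y) le_rfl)
  · exact fun m n h => lintegral_mono fun y => mul_le_mul' (hmono h y) le_rfl

theorem hardySum_congr {ν : Measure ℝ} {k k' : ℝ → ℝ≥0∞} (h : k =ᵐ[ν] k') :
    hardySum ν k = hardySum ν k' := by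
  funext x
  have h1 := lintegral_congr_ae (μ := ν.restrict (Iio x))
    (f := fun y => k y * (ENNReal.ofReal y / ν (Iio y)))
    (g := fun y => k' y * (ENNReal.ofReal y / ν (Iio y)))
    (by filter_upwards [ae_restrict_of_ae h] with y hy; rw [hy])
  have h2 := lintegral_congr_ae (μ := ν.restrict (Ioi x))
    (f := fun y => k y * (ν (Iio y))⁻¹) (g := fun y => k' y * (ν (Iio y))⁻¹)
    (by filter_upwards [ae_restrict_of_ae h] with y hy; rw [hy])
  rw [hardySum, hardySum, h1, h2]

/-- The truncations of a function on `ℝ₊`. -/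
noncomputable def truncation (k : ℝ → ℝ≥0∞) (n : ℕ) : ℝ → ℝ≥0∞ :=
  (Icc ((n : ℝ) + 1)⁻¹ (n + 1)).indicator fun y => min (k y) n

theorem measurable_truncation {k : ℝ → ℝ≥0∞} (hk : Measurable k) (n : ℕ) :
    Measurable (truncation k n) :=
  (hk.min measurable_const).indicator measurableSet_Icc

theorem truncation_le (k : ℝ → ℝ≥0∞) (n : ℕ) : truncation k n ≤ k :=
  indicator_le fun _ _ => min_le_left _ _

theorem truncation_mono (k : ℝ → ℝ≥0∞) : Monotone (truncation k) := by
  intro m n h y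
  have hmn : (m : ℝ) ≤ n := by exact_mod_cast h
  by_cases hy : y ∈ Icc ((m : ℝ) + 1)⁻¹ (m + 1)
  · have hy' : y ∈ Icc ((n : ℝ) + 1)⁻¹ (n + 1) := by
      refine Icc_subset_Icc ?_ ?_ hy <;> gcongr
    rw [truncation, truncation, indicator_of_mem hy, indicator_of_mem hy']
    exact min_le_min le_rfl (by exact_mod_cast h)
  · rw [truncation, indicator_of_notMem hy]
    exact zero_le

theorem iSup_truncation (k : ℝ → ℝ≥0∞) {y : ℝ} (hy : 0 < y) : ⨆ n, truncation k n y = k y := by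
  refine le_antisymm (iSup_le fun n => truncation_le k n y) ?_
  refine le_of_forall_lt_imp_le_of_dense fun a ha => ?_
  obtain ⟨n₁, h₁⟩ := exists_nat_gt y
  obtain ⟨n₂, h₂⟩ := exists_nat_gt y⁻¹
  obtain ⟨n₃, h₃⟩ := ENNReal.exists_nat_gt (ha.ne_top)
  set n := max n₁ (max n₂ n₃) with hn
  have i1 : (n₁ : ℝ) ≤ n := by exact_mod_cast le_max_left _ _
  have i2 : (n₂ : ℝ) ≤ n := by exact_mod_cast (le_max_left _ _).trans (le_max_right _ _)
  have i3 : (n₃ : ℝ≥0∞) ≤ n := by exact_mod_cast (le_max_right _ _).trans (le_max_right _ _)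
  refine le_trans ?_ (le_iSup _ n)
  have hmem : y ∈ Icc ((n : ℝ) + 1)⁻¹ (n + 1) := by
    constructor
    · rw [inv_le_comm₀ (by positivity) hy]
      linarith
    · linarith
  rw [truncation, indicator_of_mem hmem]
  exact le_min ha.le (h₃.le.trans i3)

variable {ν : Measure ℝ} [NullSingletonClass ν] [SFinite ν] {φ : ℝ≥0∞ ≃o ℝ≥0∞}

/-- The modular inequality for the sum of the two Hardy operators. -/
theorem exists_lintegral_hardySum_le (h0 : ν (Iic 0) = 0) (hfin : ∀ x, ν (Iio x) ≠ ∞)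
    (hpos : ∀ x, 0 < x → ν (Iio x) ≠ 0)
    (hα : ∃ c : ℝ≥0∞, c ≠ 0 ∧ c ≠ ∞ ∧ ∀ r : ℝ≥0∞, r ≠ 0 → r ≠ ∞ → ∀ x : ℝ, 0 < x →
      φ (c * (∫⁻ y in Ioi x, nFunction φ.symm (r / ν (Iio y)) ∂ν) / r) * ν (Iio x) ≤ c⁻¹ * r)
    (hβ : ∃ c : ℝ≥0∞, c ≠ 0 ∧ c ≠ ∞ ∧ ∀ r : ℝ≥0∞, r ≠ 0 → r ≠ ∞ → ∀ x : ℝ, 0 < x →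
      ∫⁻ y in Iio x, φ.symm (c * (∫⁻ z in Ioi x, nFunction φ (r / ENNReal.ofReal z) ∂ν) / r *
        (ENNReal.ofReal y / ν (Iio y))) * (ENNReal.ofReal y / ν (Iio y)) ∂ν ≤ c⁻¹ * r) :
    ∃ D : ℝ≥0∞, D ≠ ∞ ∧ ∀ k : ℝ → ℝ≥0∞, Measurable k →
      ∫⁻ x, nFunction φ (hardySum ν k x) ∂ν ≤ 3 * ∫⁻ x, growth φ (D * k x) ∂ν := by
  obtain ⟨c, hc0, hc, hα⟩ := hα
  obtain ⟨c', hc0', hc', hβ⟩ := hβ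
  -- The constants of the lower and upper operators, each doubled by splitting Φ of a sum.
  refine ⟨8 / c' * 2 + 32 / c * 2, ?_, ?_⟩
  · simp [ENNReal.div_eq_top, ENNReal.mul_eq_top, hc0, hc0']
  set D : ℝ≥0∞ := 8 / c' * 2 + 32 / c * 2
  intro k hk
  have hν : ∀ᵐ y ∂ν, 0 < y := by
    rw [ae_iff]
    simp only [not_lt]
    exact h0
  -- Truncation supplies the finiteness and vanishing conditions of both operator bounds; the
  -- constant is independent of n.
  have htrunc : ∀ n, ∫⁻ x, nFunction φ (hardySum ν (truncation k n) x) ∂ν ≤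
      3 * ∫⁻ x, growth φ (D * k x) ∂ν := by
    intro n
    set q := truncation k n with hq
    have hqm : Measurable q := measurable_truncation hk n
    have hq2m : Measurable fun y => 2 * q y := hqm.const_mul 2
    set a : ℝ := ((n : ℝ) + 1)⁻¹ with ha
    have ha0 : 0 < a := by positivity
    have hqle : ∀ y, 2 * q y * (ν (Iio y))⁻¹ ≤
        (Iio ((n : ℝ) + 2)).indicator (fun _ => 2 * n * (ν (Iio a))⁻¹) y := by
      intro y
      by_cases hy : y ∈ Icc a (n + 1)
      · rw [indicator_of_mem (mem_Iio.2 (by linarith [hy.2]))]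
        rw [hq, truncation, indicator_of_mem hy]
        exact mul_le_mul' (mul_le_mul' le_rfl (min_le_right _ _))
          (ENNReal.inv_le_inv.2 (measure_mono (Iio_subset_Iio hy.1)))
      · rw [hq, truncation, indicator_of_notMem hy, mul_zero, zero_mul]
        exact zero_le
    set B : ℝ≥0∞ := 2 * n * (ν (Iio a))⁻¹ * ν (Iio ((n : ℝ) + 2)) with hB
    have hBt : B ≠ ∞ := ENNReal.mul_ne_top (ENNReal.mul_ne_top (ENNReal.mul_ne_top (by norm_num)
      (by simp)) (ENNReal.inv_ne_top.2 (hpos a ha0))) (hfin _)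
    have hint : ∫⁻ y, 2 * q y * (ν (Iio y))⁻¹ ∂ν ≤ B := by
      refine (lintegral_mono hqle).trans_eq ?_
      rw [lintegral_indicator measurableSet_Iio, setLIntegral_const]
    have hlow : ∀ x, ∫⁻ y in Iio x, 2 * q y * (ENNReal.ofReal y / ν (Iio y)) ∂ν ≠ ∞ := by
      intro x
      have : ∫⁻ y in Iio x, 2 * q y * (ENNReal.ofReal y / ν (Iio y)) ∂ν ≤
          ∫⁻ y, ENNReal.ofReal (n + 1) * (2 * q y * (ν (Iio y))⁻¹) ∂ν := by
        refine (setLIntegral_le_lintegral _ _).trans (lintegral_mono fun y => ?_)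
        by_cases hy : y ∈ Icc a (n + 1)
        · rw [div_eq_mul_inv, mul_left_comm]
          exact mul_le_mul' (ENNReal.ofReal_le_ofReal hy.2) le_rfl
        · rw [hq, truncation, indicator_of_notMem hy, mul_zero, zero_mul]
          exact zero_le
      refine ne_top_of_le_ne_top ?_ this
      rw [lintegral_const_mul' _ _ ENNReal.ofReal_ne_top]
      exact ENNReal.mul_ne_top ENNReal.ofReal_ne_top (ne_top_of_le_ne_top hBt hint)
    have hup : ∀ x, (n : ℝ) + 1 ≤ x → ∫⁻ y in Ioi x, 2 * q y * (ν (Iio y))⁻¹ ∂ν = 0 := by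
      intro x hx
      rw [setLIntegral_congr_fun (g := fun _ => 0) measurableSet_Ioi]
      · simp
      · intro y hy
        have : y ∉ Icc a (n + 1) := fun h => absurd (hx.trans_lt hy) h.2.not_gt
        change 2 * truncation k n y * (ν (Iio y))⁻¹ = 0
        rw [truncation, indicator_of_notMem this, mul_zero, zero_mul]
    have e1 := lintegral_nFunction_lower_le h0 hfin hpos hc0' hc' hβ hq2m hlow
    have e2 := lintegral_growth_upper_le h0 hfin hpos hc0 hc hα hq2m hBt
      (fun x => (setLIntegral_le_lintegral _ _).trans hint) hup
    have hgD : ∀ {d : ℝ≥0∞}, d * 2 ≤ D → ∫⁻ x, growth φ (d * (2 * q x)) ∂ν ≤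
        ∫⁻ x, growth φ (D * k x) ∂ν := fun {d} hd => lintegral_mono fun x =>
      growth_mono φ (by rw [← mul_assoc]; exact mul_le_mul' hd (truncation_le k n x))
    have hm1 : Measurable fun x => nFunction φ ((ENNReal.ofReal x)⁻¹ *
        ∫⁻ y in Iio x, 2 * q y * (ENNReal.ofReal y / ν (Iio y)) ∂ν) :=
      (nFunction_mono φ).measurable.comp (ENNReal.measurable_ofReal.inv.mul (Monotone.measurable
        fun _ _ h => lintegral_mono_set (Iio_subset_Iio h)))
    calc ∫⁻ x, nFunction φ (hardySum ν q x) ∂ν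
        ≤ ∫⁻ x, (nFunction φ ((ENNReal.ofReal x)⁻¹ *
            ∫⁻ y in Iio x, 2 * q y * (ENNReal.ofReal y / ν (Iio y)) ∂ν) +
            growth φ (∫⁻ y in Ioi x, 2 * q y * (ν (Iio y))⁻¹ ∂ν)) ∂ν := by
          refine lintegral_mono fun x => (nFunction_add_le φ _ _).trans (add_le_add ?_ ?_)
          · refine (congrArg _ ?_).le
            simp only [mul_assoc (2 : ℝ≥0∞)]
            rw [lintegral_const_mul' _ _ (by norm_num), mul_left_comm]
          · refine (nFunction_le_growth φ _).trans_eq (congrArg _ ?_)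
            simp only [mul_assoc (2 : ℝ≥0∞)]
            rw [lintegral_const_mul' _ _ (by norm_num)]
      _ ≤ ∫⁻ x, growth φ (D * k x) ∂ν + 2 * ∫⁻ x, growth φ (D * k x) ∂ν := by
          rw [lintegral_add_left hm1]
          exact add_le_add (e1.trans (hgD le_self_add))
            (e2.trans (mul_le_mul' le_rfl (hgD le_add_self)))
      _ = _ := by ring
  have hk' : k =ᵐ[ν] fun y => ⨆ n, truncation k n y := by
    filter_upwards [hν] with y hy
    rw [iSup_truncation k hy]
  rw [hardySum_congr hk']
  simp only [hardySum_iSup ν (measurable_truncation hk) (truncation_mono k)]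
  have hmono : ∀ x, Monotone fun n => hardySum ν (truncation k n) x :=
    fun x m n h => hardySum_mono ν (truncation_mono k h) x
  simp only [nFunction_iSup φ (hmono _)]
  rw [lintegral_iSup (f := fun n x => nFunction φ (hardySum ν (truncation k n) x))
    (fun n => (nFunction_mono φ).measurable.comp (measurable_hardySum ν _))
    fun _ _ h x => nFunction_mono φ (hmono x h)]
  exact iSup_le htrunc

end HardySum

/-! ### Dilation of decreasing functions in the variable U. -/

section Quantile

theorem measure_univ_le_of_Iio {ν : Measure ℝ} {c : ℝ≥0∞} (h : ∀ x, ν (Iio x) ≤ c) :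
    ν univ ≤ c := by
  have hU : (⋃ n : ℕ, Iio (n : ℝ)) = univ := by
    ext y
    simpa using exists_nat_gt y
  rw [← hU]
  exact le_of_tendsto' (tendsto_measure_iUnion_atTop fun a b hab =>
    Iio_subset_Iio (by exact_mod_cast hab)) fun n => h n

theorem measure_setOf_measure_Iio_le {ν : Measure ℝ} [NullSingletonClass ν] (h0 : ν (Iic 0) = 0)
    (hfin : ∀ x, ν (Iio x) ≠ ∞) (c : ℝ≥0∞) : ν {y | ν (Iio y) ≤ c} ≤ c := by
  by_cases h : ∃ x, c < ν (Iio x)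
  · obtain ⟨x, hx⟩ := h
    obtain ⟨s, -, hs, hiff⟩ := exists_level h0 hfin hx
    have : {y | ν (Iio y) ≤ c} = Iic s := by
      ext y
      exact hiff y
    rw [this, ← measure_congr (Iio_ae_eq_Iic (μ := ν)), hs]
  · push Not at h
    exact (measure_mono (subset_univ _)).trans (measure_univ_le_of_Iio h)

/-- The smallest point at which the distribution function of `ν` is at least `c / 2`. -/
noncomputable def halfQuantile (ν : Measure ℝ) (c : ℝ≥0∞) : ℝ :=
  sInf {t : ℝ | 0 < t ∧ c ≤ 2 * ν (Iio t)}

theorem halfQuantile_le {ν : Measure ℝ} {c : ℝ≥0∞} {t : ℝ} (ht : 0 < t)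
    (h : c ≤ 2 * ν (Iio t)) : halfQuantile ν c ≤ t :=
  csInf_le ⟨0, fun _ hs => hs.1.le⟩ ⟨ht, h⟩

theorem le_two_mul_measure_halfQuantile {ν : Measure ℝ} [NullSingletonClass ν]
    (hfin : ∀ x, ν (Iio x) ≠ ∞) {c : ℝ≥0∞} {t : ℝ} (ht : 0 < t) (h : c ≤ 2 * ν (Iio t)) :
    c ≤ 2 * ν (Iio (halfQuantile ν c)) := by
  have hcont : Continuous fun x => 2 * ν (Iio x) :=
    ENNReal.continuous_const_mul (by norm_num) |>.comp (continuous_measure_Iio ν hfin)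
  have hcl : IsClosed {t : ℝ | c ≤ 2 * ν (Iio t)} := isClosed_le continuous_const hcont
  have hmem : halfQuantile ν c ∈ closure {t : ℝ | 0 < t ∧ c ≤ 2 * ν (Iio t)} :=
    csInf_mem_closure ⟨t, ht, h⟩ ⟨0, fun _ hs => hs.1.le⟩
  exact closure_minimal (fun _ hs => hs.2) hcl hmem

theorem halfQuantile_measure_mono (ν : Measure ℝ) :
    Monotone fun y => halfQuantile ν (ν (Iio y)) := by
  intro y y' h
  refine csInf_le_csInf ⟨0, fun _ hs => hs.1.le⟩ ?_
    fun t ht => ⟨ht.1, (measure_mono (Iio_subset_Iio h)).trans ht.2⟩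
  refine ⟨max y' 1, by positivity, ?_⟩
  rw [two_mul]
  exact (measure_mono (Iio_subset_Iio (le_max_left _ _))).trans le_self_add

variable {ν : Measure ℝ} [NullSingletonClass ν]

/-- Pointwise bound of a decreasing function by the upper Hardy operator of a dilation of it. -/
theorem le_lintegral_Ioi_halfQuantile (h0 : ν (Iic 0) = 0) (hfin : ∀ x, ν (Iio x) ≠ ∞)
    (hpos : ∀ x, 0 < x → ν (Iio x) ≠ 0) {g : ℝ → ℝ≥0∞} (hg : Antitone g) {x z : ℝ} (hx : 0 < x)
    (hz : 2 * ν (Iio x) < ν (Iio z)) :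
    g x ≤ 2 * ∫⁻ y in Ioi x, g (halfQuantile ν (ν (Iio y))) * (ν (Iio y))⁻¹ ∂ν := by
  obtain ⟨s, -, hs, hiff⟩ := exists_level h0 hfin hz
  have hU0 := hpos x hx
  have hUt := hfin x
  set u := ν (Iio x) with hu
  -- Since U(s) = 2U(x), the interval (x, s) carries mass at least U(x). There U(y) ≤ 2U(x), so the
  -- half-quantile of U(y) is at most x and the dilated g is at least g(x).
  have h1 : u ≤ ν (Ioo x s) := by
    have hsub : Iio s ⊆ Iic x ∪ Ioo x s := by
      intro y hy
      rcases le_or_gt y x with h | h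
      · exact Or.inl h
      · exact Or.inr ⟨h, hy⟩
    have h2 : ν (Iio s) ≤ ν (Iic x) + ν (Ioo x s) :=
      (measure_mono hsub).trans (measure_union_le _ _)
    rw [hs, ← measure_congr (Iio_ae_eq_Iic (μ := ν)), ← hu, two_mul] at h2
    exact ENNReal.le_of_add_le_add_left hUt h2
  have h2 : g x * (2 * u)⁻¹ * u ≤
      ∫⁻ y in Ioi x, g (halfQuantile ν (ν (Iio y))) * (ν (Iio y))⁻¹ ∂ν := by
    calc g x * (2 * u)⁻¹ * u ≤ ∫⁻ _ in Ioo x s, g x * (2 * u)⁻¹ ∂ν := by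
          rw [setLIntegral_const]
          exact mul_le_mul' le_rfl h1
      _ ≤ ∫⁻ y in Ioo x s, g (halfQuantile ν (ν (Iio y))) * (ν (Iio y))⁻¹ ∂ν := by
          refine setLIntegral_mono' measurableSet_Ioo fun y hy => ?_
          have hy2 : ν (Iio y) ≤ 2 * u := (hiff y).2 hy.2.le
          exact mul_le_mul' (hg (halfQuantile_le hx hy2)) (ENNReal.inv_le_inv.2 hy2)
      _ ≤ _ := lintegral_mono_set Ioo_subset_Ioi_self
  calc g x = 2 * (g x * (2 * u)⁻¹ * u) := by
        rw [ENNReal.mul_inv (by simp) (by simp)]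
        calc g x = (2 * 2⁻¹) * (u * u⁻¹) * g x := by
              rw [ENNReal.mul_inv_cancel (by norm_num) (by norm_num),
                ENNReal.mul_inv_cancel hU0 hUt, one_mul, one_mul]
          _ = _ := by ring
    _ ≤ _ := mul_le_mul' le_rfl h2

variable [SFinite ν]

/-- Level by level: if G exceeds r at the half-quantile of U(y), the superlevel set A contains
everything to its left, so U(y) ≤ 2ν(A); such y > 0 have total mass at most 2ν(A). -/
theorem lintegral_comp_halfQuantile_le (h0 : ν (Iic 0) = 0) (hfin : ∀ x, ν (Iio x) ≠ ∞)
    {G : ℝ → ℝ≥0∞} (hG : Antitone G) :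
    ∫⁻ y, G (halfQuantile ν (ν (Iio y))) ∂ν ≤ 2 * ∫⁻ y, G y ∂ν := by
  have hGm : Measurable fun y => G (halfQuantile ν (ν (Iio y))) :=
    (hG.comp_monotone (halfQuantile_measure_mono ν)).measurable
  rw [lintegral_eq_lintegral_meas_ofReal_lt _ hGm,
    lintegral_eq_lintegral_meas_ofReal_lt _ hG.measurable,
    ← lintegral_const_mul' _ _ (by norm_num)]
  refine lintegral_mono fun r => ?_
  set A := {y | ENNReal.ofReal r < G y} with hA
  have hsub : {y | ENNReal.ofReal r < G (halfQuantile ν (ν (Iio y)))} ⊆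
      Iic 0 ∪ {y | ν (Iio y) ≤ 2 * ν A} := by
    intro y hy
    rcases le_or_gt y 0 with h | h
    · exact Or.inl h
    · right
      have h1 := le_two_mul_measure_halfQuantile hfin (c := ν (Iio y)) h
        (by rw [two_mul]; exact le_self_add)
      exact h1.trans (mul_le_mul' le_rfl
        (measure_mono fun z hz => lt_of_lt_of_le hy (hG (le_of_lt hz))))
  calc _ ≤ ν (Iic 0) + ν {y | ν (Iio y) ≤ 2 * ν A} :=
        (measure_mono hsub).trans (measure_union_le _ _)
    _ ≤ 2 * ν A := by
        rw [h0, zero_add]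
        exact measure_setOf_measure_Iio_le h0 hfin _

/-- Tonelli gives y the weight |(0, x) ∩ (-∞, y)| ≤ min(y, x); splitting at y = x produces the two
Hardy operators. -/
theorem average_lintegral_Ioi_le {k : ℝ → ℝ≥0∞} (hk : Measurable k) {x : ℝ} (hx : 0 < x) :
    (ENNReal.ofReal x)⁻¹ * ∫⁻ t in Ioo 0 x, (∫⁻ y in Ioi t, k y * (ν (Iio y))⁻¹ ∂ν) ≤
      hardySum ν k x := by
  have hkm : Measurable fun y => k y * (ν (Iio y))⁻¹ := hk.mul (measurable_measure_Iio ν).inv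
  have hx0 : ENNReal.ofReal x ≠ 0 := by simpa using hx
  have hfub := lintegral_lintegral_Ioi_mul (ν := ν) (f := fun _ => 1) hkm measurable_const
    (volume.restrict (Ioo 0 x))
  simp only [mul_one, setLIntegral_const, one_mul] at hfub
  have hvol : ∀ y, (volume.restrict (Ioo 0 x)) (Iio y) ≤
      min (ENNReal.ofReal y) (ENNReal.ofReal x) := by
    intro y
    rw [Measure.restrict_apply measurableSet_Iio]
    refine le_min ?_ ?_
    · refine (measure_mono (t := Ioo 0 y) fun z hz => ⟨hz.2.1, hz.1⟩).trans ?_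
      simp
    · refine (measure_mono (t := Ioo 0 x) fun z hz => hz.2).trans ?_
      simp
  have hsplit := lintegral_add_compl (μ := ν)
    (fun y => k y * (ν (Iio y))⁻¹ * (volume.restrict (Ioo 0 x)) (Iio y))
    (measurableSet_Iio (a := x))
  rw [compl_Iio, setLIntegral_congr (Ioi_ae_eq_Ici (μ := ν) (a := x)).symm] at hsplit
  rw [hfub, ← hsplit, mul_add, hardySum]
  refine add_le_add ?_ ?_
  · refine mul_le_mul' le_rfl (lintegral_mono fun y => ?_)
    rw [mul_assoc, div_eq_mul_inv, mul_comm (ENNReal.ofReal y)]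
    exact mul_le_mul' le_rfl (mul_le_mul' le_rfl ((hvol y).trans (min_le_left _ _)))
  · calc _ ≤ (ENNReal.ofReal x)⁻¹ *
          ∫⁻ y in Ioi x, k y * (ν (Iio y))⁻¹ * ENNReal.ofReal x ∂ν :=
          mul_le_mul' le_rfl (lintegral_mono fun y =>
            mul_le_mul' le_rfl ((hvol y).trans (min_le_right _ _)))
      _ = _ := by
          rw [lintegral_mul_const _ hkm, mul_comm (∫⁻ y in Ioi x, k y * (ν (Iio y))⁻¹ ∂ν),
            ← mul_assoc, ENNReal.inv_mul_cancel hx0 ENNReal.ofReal_ne_top, one_mul]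

end Quantile

/-! ### Averages of decreasing functions. -/

section Averages

variable {ν : Measure ℝ} [NullSingletonClass ν] [SFinite ν] {φ : ℝ≥0∞ ≃o ℝ≥0∞}

/-- A modular inequality for the averaging operator on decreasing functions, given one for
the sum of the Hardy operators. -/
theorem lintegral_nFunction_average_le (h0 : ν (Iic 0) = 0) (hfin : ∀ x, ν (Iio x) ≠ ∞)
    (hpos : ∀ x, 0 < x → ν (Iio x) ≠ 0) {D : ℝ≥0∞}
    (hD : ∀ k : ℝ → ℝ≥0∞, Measurable k →
      ∫⁻ x, nFunction φ (hardySum ν k x) ∂ν ≤ 3 * ∫⁻ x, growth φ (D * k x) ∂ν)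
    {g : ℝ → ℝ≥0∞} (hg : Antitone g) :
    ∫⁻ x, nFunction φ ((ENNReal.ofReal x)⁻¹ * ∫⁻ t in Ioo 0 x, g t) ∂ν ≤
      ∫⁻ x, nFunction φ (16 * (8 * D + 2) * g x) ∂ν := by
  have hν : ∀ᵐ y ∂ν, 0 < y := by
    rw [ae_iff]
    simp only [not_lt]
    exact h0
  set k : ℝ → ℝ≥0∞ := fun y => g (halfQuantile ν (ν (Iio y))) with hk
  have hkm : Measurable k := (hg.comp_monotone (halfQuantile_measure_mono ν)).measurable
  have hk4m : Measurable fun y => 4 * k y := hkm.const_mul 4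
  -- The pointwise bound needs room to double U(x). When no doubling is possible, x lies beyond the
  -- half-quantile τ of the total mass and g(x) ≤ g(τ) = b. The constant b is affordable because (0,
  -- τ) carries at least half the mass and g ≥ b there.
  obtain ⟨b, hb1, hb2⟩ : ∃ b : ℝ≥0∞,
      (∀ x, 0 < x → g x ≤ 2 * (∫⁻ y in Ioi x, k y * (ν (Iio y))⁻¹ ∂ν) + b) ∧
      ∫⁻ _, nFunction φ (2 * b) ∂ν ≤ 2 * ∫⁻ x, nFunction φ (2 * g x) ∂ν := by
    by_cases h : ∃ t, 0 < t ∧ ν univ ≤ 2 * ν (Iio t)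
    · obtain ⟨t, ht0, ht⟩ := h
      refine ⟨g (halfQuantile ν (ν univ)), fun x hx => ?_, ?_⟩
      · by_cases hz : ∃ z, 2 * ν (Iio x) < ν (Iio z)
        · obtain ⟨z, hz⟩ := hz
          exact (le_lintegral_Ioi_halfQuantile h0 hfin hpos hg hx hz).trans le_self_add
        · push Not at hz
          refine le_trans (hg (halfQuantile_le hx (measure_univ_le_of_Iio hz))) le_add_self
      · have h1 := le_two_mul_measure_halfQuantile hfin ht0 ht
        set τ := halfQuantile ν (ν univ)
        calc ∫⁻ _, nFunction φ (2 * g τ) ∂ν = nFunction φ (2 * g τ) * ν univ := lintegral_const _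
          _ ≤ nFunction φ (2 * g τ) * (2 * ν (Iio τ)) := mul_le_mul' le_rfl h1
          _ = 2 * ∫⁻ _ in Iio τ, nFunction φ (2 * g τ) ∂ν := by
              rw [setLIntegral_const, mul_left_comm]
          _ ≤ 2 * ∫⁻ x in Iio τ, nFunction φ (2 * g x) ∂ν := by
              refine mul_le_mul' le_rfl (setLIntegral_mono' measurableSet_Iio fun x hx => ?_)
              exact nFunction_mono φ (mul_le_mul' le_rfl (hg (le_of_lt hx)))
          _ ≤ _ := mul_le_mul' le_rfl (setLIntegral_le_lintegral _ _)
    · push Not at h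
      refine ⟨0, fun x hx => ?_, by simp [nFunction_zero]⟩
      have : ∃ z, 2 * ν (Iio x) < ν (Iio z) := by
        by_contra! hz
        exact absurd (h x hx) (not_lt.2 (measure_univ_le_of_Iio hz))
      obtain ⟨z, hz⟩ := this
      exact (le_lintegral_Ioi_halfQuantile h0 hfin hpos hg hx hz).trans le_self_add
  have hpt : ∀ x, 0 < x → (ENNReal.ofReal x)⁻¹ * ∫⁻ t in Ioo 0 x, g t ≤
      2 * hardySum ν k x + b := by
    intro x hx
    have hinner : Measurable fun t => ∫⁻ y in Ioi t, k y * (ν (Iio y))⁻¹ ∂ν :=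
      Antitone.measurable fun _ _ h => lintegral_mono_set (Ioi_subset_Ioi h)
    calc (ENNReal.ofReal x)⁻¹ * ∫⁻ t in Ioo 0 x, g t
        ≤ (ENNReal.ofReal x)⁻¹ *
            ∫⁻ t in Ioo 0 x, (2 * (∫⁻ y in Ioi t, k y * (ν (Iio y))⁻¹ ∂ν) + b) :=
          mul_le_mul' le_rfl (setLIntegral_mono' measurableSet_Ioo fun t ht => hb1 t ht.1)
      _ = 2 * ((ENNReal.ofReal x)⁻¹ *
            ∫⁻ t in Ioo 0 x, (∫⁻ y in Ioi t, k y * (ν (Iio y))⁻¹ ∂ν)) + b := by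
          rw [lintegral_add_right _ measurable_const, lintegral_const_mul _ hinner,
            setLIntegral_const, Real.volume_Ioo, sub_zero, mul_add, mul_left_comm,
            mul_comm b, ← mul_assoc _ _ b,
            ENNReal.inv_mul_cancel (by simpa using hx) ENNReal.ofReal_ne_top, one_mul]
      _ ≤ _ := add_le_add (mul_le_mul' le_rfl (average_lintegral_Ioi_le hkm hx)) le_rfl
  have hm : Measurable fun x => nFunction φ (hardySum ν (fun y => 4 * k y) x) :=
    (nFunction_mono φ).measurable.comp (measurable_hardySum ν _)
  set M : ℝ≥0∞ := 8 * D + 2 with hM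
  set J := ∫⁻ x, nFunction φ (M * g x) ∂ν with hJ
  have hJk : ∫⁻ x, growth φ (D * (4 * k x)) ∂ν ≤ 2 * J := by
    calc ∫⁻ x, growth φ (D * (4 * k x)) ∂ν ≤ ∫⁻ x, nFunction φ (M * k x) ∂ν := by
          refine lintegral_mono fun x => (growth_le_nFunction φ _).trans (nFunction_mono φ ?_)
          rw [show 2 * (D * (4 * k x)) = 8 * D * k x by ring]
          exact mul_le_mul' le_self_add le_rfl
      _ ≤ 2 * J := lintegral_comp_halfQuantile_le h0 hfin (G := fun x => nFunction φ (M * g x))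
          fun _ _ h => nFunction_mono φ (mul_le_mul' le_rfl (hg h))
  calc ∫⁻ x, nFunction φ ((ENNReal.ofReal x)⁻¹ * ∫⁻ t in Ioo 0 x, g t) ∂ν
      ≤ ∫⁻ x, (nFunction φ (hardySum ν (fun y => 4 * k y) x) + nFunction φ (2 * b)) ∂ν := by
        refine lintegral_mono_ae ?_
        filter_upwards [hν] with x hx
        refine (nFunction_mono φ (hpt x hx)).trans ((nFunction_add_le φ _ _).trans_eq ?_)
        rw [hardySum_const_mul ν hkm, ← mul_assoc]
        norm_num
    _ = ∫⁻ x, nFunction φ (hardySum ν (fun y => 4 * k y) x) ∂ν + ∫⁻ _, nFunction φ (2 * b) ∂ν :=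
        lintegral_add_left hm _
    -- The total 8J is moved inside Φ as a dilation by 16; M = 8D + 2 covers both the dilation 8D
    -- from the Hardy sum and the 2 from b.
    _ ≤ 3 * (2 * J) + 2 * J := by
        refine add_le_add ((hD _ hk4m).trans (mul_le_mul' le_rfl hJk))
          (hb2.trans (mul_le_mul' le_rfl (lintegral_mono fun x => nFunction_mono φ ?_)))
        exact mul_le_mul' le_add_self le_rfl
    _ = ∫⁻ x, 8 * nFunction φ (M * g x) ∂ν := by
        rw [lintegral_const_mul' _ _ (by norm_num)]
        ring
    _ ≤ _ := by
        refine lintegral_mono fun x => (const_mul_nFunction_le φ (by norm_num) _).trans_eq ?_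
        rw [← mul_assoc]
        norm_num

end Averages

/-! ### The weight cannot vanish near 0 unless it is zero. -/

section Positivity

theorem nFunction_ne_zero (φ : ℝ≥0∞ ≃o ℝ≥0∞) {a : ℝ≥0∞} (ha : a ≠ 0) : nFunction φ a ≠ 0 := by
  have h1 := growth_le_nFunction φ (2⁻¹ * a)
  rw [← mul_assoc, ENNReal.mul_inv_cancel (by norm_num) (by norm_num), one_mul] at h1
  have h2 : 2⁻¹ * a ≠ 0 := mul_ne_zero (by simp) ha
  have h3 : growth φ (2⁻¹ * a) ≠ 0 :=
    mul_ne_zero h2 fun h => h2 (φ.injective (h.trans φ.map_bot.symm))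
  exact fun h => h3 (le_antisymm (h1.trans_eq h) zero_le)

/-- The `β` condition forces a nonzero measure to charge every interval `(0, x)`. -/
theorem measure_Iio_ne_zero {ν : Measure ℝ} [NullSingletonClass ν] {φ : ℝ≥0∞ ≃o ℝ≥0∞}
    (h0 : ν (Iic 0) = 0) (hfin : ∀ x, ν (Iio x) ≠ ∞) (hν : ν ≠ 0) {c : ℝ≥0∞} (hc0 : c ≠ 0)
    (hβ : ∀ r : ℝ≥0∞, r ≠ 0 → r ≠ ∞ → ∀ x : ℝ, 0 < x →
      ∫⁻ y in Iio x, φ.symm (c * (∫⁻ z in Ioi x, nFunction φ (r / ENNReal.ofReal z) ∂ν) / r *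
        (ENNReal.ofReal y / ν (Iio y))) * (ENNReal.ofReal y / ν (Iio y)) ∂ν ≤ c⁻¹ * r)
    {a : ℝ} (ha : 0 < a) : ν (Iio a) ≠ 0 := by
  intro hUa
  have hmono : Monotone fun y => ν (Iio y) := fun _ _ h => measure_mono (Iio_subset_Iio h)
  obtain ⟨z, hz⟩ : ∃ z, ν (Iio z) ≠ 0 := by
    by_contra! h
    exact hν (Measure.measure_univ_eq_zero.1
      (le_antisymm (measure_univ_le_of_Iio fun x => (h x).le) zero_le))
  obtain ⟨s, -, hs, hsiff⟩ := exists_level h0 hfin (ENNReal.half_lt_self hz (hfin z))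
  have hs0 : ν (Iio s) ≠ 0 := by
    rw [hs]
    exact (ENNReal.half_pos hz).ne'
  have has : a < s := by
    by_contra! h
    exact hs0 (le_antisymm ((hmono h).trans_eq hUa) zero_le)
  have htail : ν (Ioi s) ≠ 0 := by
    intro h
    have h1 : ν (Iio z) ≤ ν (Iic s) + ν (Ioi s) := by
      refine (measure_mono (subset_univ _)).trans ?_
      rw [← Iic_union_Ioi (a := s)]
      exact measure_union_le _ _
    rw [h, add_zero, ← measure_congr (Iio_ae_eq_Iic (μ := ν)), hs] at h1
    exact absurd h1 (ENNReal.half_lt_self hz (hfin z)).not_ge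
  have hsp : 0 < s := ha.trans has
  have hb := hβ 1 one_ne_zero ENNReal.one_ne_top s hsp
  set B := ∫⁻ z in Ioi s, nFunction φ (1 / ENNReal.ofReal z) ∂ν with hB
  have hB0 : B ≠ 0 := by
    intro h
    have hm : Measurable fun z => nFunction φ (1 / ENNReal.ofReal z) :=
      (nFunction_mono φ).measurable.comp (measurable_const.div ENNReal.measurable_ofReal)
    rw [hB, lintegral_eq_zero_iff hm] at h
    have h2 : ∀ᵐ z ∂(ν.restrict (Ioi s)), False := by
      filter_upwards [h] with z hz'
      exact nFunction_ne_zero φ (ENNReal.div_ne_zero.2 ⟨one_ne_zero, ENNReal.ofReal_ne_top⟩) hz'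
    rw [Filter.eventually_false_iff_eq_bot, ae_eq_bot, Measure.restrict_eq_zero] at h2
    exact htail h2
  set q : ℝ≥0∞ := φ.symm (c * B / 1 * (ENNReal.ofReal a / ν (Iio s))) * ENNReal.ofReal a with hq
  have ha' : ENNReal.ofReal a ≠ 0 := by simpa using ha
  have hq0 : q ≠ 0 := by
    refine mul_ne_zero (fun h => ?_) ha'
    have h1 := φ.symm.injective (h.trans φ.symm.map_bot.symm)
    refine mul_ne_zero ?_ (ENNReal.div_ne_zero.2 ⟨ha', hfin s⟩) h1
    simpa using ⟨hc0, hB0⟩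
  -- The β condition at r = 1, x = s bounds a positive multiple of ∫ dU/U over (a, s). If U(a) = 0
  -- this integral diverges logarithmically: its part below any t with U(t) > 0 is at least 1,
  -- contradicting absolute continuity of the integral as U(t) → 0.
  have hI : ∫⁻ y in Ioo a s, (ν (Iio y))⁻¹ ∂ν ≠ ∞ := by
    intro h
    have h1 : q * ∫⁻ y in Ioo a s, (ν (Iio y))⁻¹ ∂ν ≤ c⁻¹ * 1 := by
      rw [← lintegral_const_mul (f := fun y => (ν (Iio y))⁻¹) _ (measurable_measure_Iio ν).inv]
      refine le_trans (le_trans (setLIntegral_mono' measurableSet_Ioo fun y hy => ?_)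
        (lintegral_mono_set (Ioo_subset_Iio_self (a := a)))) hb
      rw [hq, mul_assoc, div_eq_mul_inv (ENNReal.ofReal y)]
      have h2 : ENNReal.ofReal a ≤ ENNReal.ofReal y := ENNReal.ofReal_le_ofReal hy.1.le
      refine mul_le_mul' (φ.symm.monotone (mul_le_mul' le_rfl ?_)) (mul_le_mul' h2 le_rfl)
      rw [div_eq_mul_inv]
      exact mul_le_mul' h2 (ENNReal.inv_le_inv.2 (hmono hy.2.le))
    rw [h, ENNReal.mul_top hq0, mul_one] at h1
    exact ENNReal.inv_ne_top.2 hc0 (top_le_iff.1 h1)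
  obtain ⟨δ, hδ, hδI⟩ := exists_pos_setLIntegral_lt_of_measure_lt hI one_ne_zero
  have hmin0 : min δ (ν (Iio s)) ≠ 0 := (lt_min hδ (pos_iff_ne_zero.2 hs0)).ne'
  have hlt : min δ (ν (Iio s)) / 2 < min δ (ν (Iio s)) :=
    ENNReal.half_lt_self hmin0 (ne_top_of_le_ne_top (hfin s) (min_le_right _ _))
  obtain ⟨t, -, ht, htiff⟩ := exists_level h0 hfin (hlt.trans_le (min_le_right _ _))
  have ht0 : ν (Iio t) ≠ 0 := by
    rw [ht]
    exact (ENNReal.half_pos hmin0).ne'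
  have hts : t ≤ s := by
    by_contra! h
    exact absurd ((hmono h.le).trans_eq ht) (hlt.trans_le (min_le_right _ _)).not_ge
  have h1 := hδI (Iio t) ((Measure.restrict_apply_le _ _).trans_lt
    (ht.trans_lt (hlt.trans_le (min_le_left _ _))))
  rw [Measure.restrict_restrict measurableSet_Iio] at h1
  refine absurd h1 (not_lt.2 ?_)
  have hmass : ν (Iio t) ≤ ν (Iio t ∩ Ioo a s) := by
    have hsub : Iio t ⊆ Iic a ∪ (Iio t ∩ Ioo a s) := by
      intro y hy
      rcases le_or_gt y a with h | h
      · exact Or.inl h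
      · exact Or.inr ⟨hy, h, lt_of_lt_of_le hy hts⟩
    refine (measure_mono hsub).trans ((measure_union_le _ _).trans ?_)
    rw [← measure_congr (Iio_ae_eq_Iic (μ := ν)), hUa, zero_add]
  calc (1 : ℝ≥0∞) = (ν (Iio t))⁻¹ * ν (Iio t) := (ENNReal.inv_mul_cancel ht0 (hfin t)).symm
    _ ≤ (ν (Iio t))⁻¹ * ν (Iio t ∩ Ioo a s) := mul_le_mul' le_rfl hmass
    _ = ∫⁻ _ in Iio t ∩ Ioo a s, (ν (Iio t))⁻¹ ∂ν := (setLIntegral_const _ _).symm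
    _ ≤ _ := setLIntegral_mono' (measurableSet_Iio.inter measurableSet_Ioo) fun y hy =>
        ENNReal.inv_le_inv.2 (hmono (le_of_lt hy.1))

end Positivity

/-! ### Translation to the measure u dx, degenerate weights, and passage to gauges. -/

section Weight

/-- The measure on `ℝ₊` with density `u`. -/
noncomputable def weightMeasure (u : ℝ → ℝ≥0∞) : Measure ℝ :=
  (volume.restrict (Ioi 0)).withDensity u

instance nullSingletonClass_weightMeasure (u : ℝ → ℝ≥0∞) :
    NullSingletonClass (weightMeasure u) :=
  nullSingletonClass_withDensity _

instance sFinite_weightMeasure (u : ℝ → ℝ≥0∞) : SFinite (weightMeasure u) :=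
  inferInstanceAs (SFinite ((volume.restrict (Ioi 0)).withDensity u))

theorem weightMeasure_Iic_zero (u : ℝ → ℝ≥0∞) : weightMeasure u (Iic 0) = 0 := by
  refine withDensity_absolutelyContinuous _ _ ?_
  rw [Measure.restrict_apply measurableSet_Iic, Iic_inter_Ioi, Ioc_self, measure_empty]

theorem setLIntegral_weightMeasure {u : ℝ → ℝ≥0∞} (hu : MPos u) {s : Set ℝ} (hs : MeasurableSet s)
    {F : ℝ → ℝ≥0∞} (hF : Measurable F) :
    ∫⁻ x in s, F x ∂(weightMeasure u) = ∫⁻ x in s ∩ Ioi 0, F x * u x := by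
  rw [weightMeasure, setLIntegral_withDensity_eq_lintegral_mul₀ hu hF.aemeasurable hs,
    Measure.restrict_restrict hs]
  exact lintegral_congr fun x => mul_comm _ _

theorem lintegral_weightMeasure {u : ℝ → ℝ≥0∞} (hu : MPos u) {F : ℝ → ℝ≥0∞} (hF : Measurable F) :
    ∫⁻ x, F x ∂(weightMeasure u) = ∫⁻ x in Ioi 0, F x * u x := by
  rw [← setLIntegral_univ, setLIntegral_weightMeasure hu MeasurableSet.univ hF, univ_inter]

theorem weightMeasure_apply (u : ℝ → ℝ≥0∞) {s : Set ℝ} (hs : MeasurableSet s) :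
    weightMeasure u s = ∫⁻ x in s ∩ Ioi 0, u x := by
  rw [weightMeasure, withDensity_apply _ hs, Measure.restrict_restrict hs]

theorem weightMeasure_Iio (u : ℝ → ℝ≥0∞) (x : ℝ) :
    weightMeasure u (Iio x) = weightPrimitive u x := by
  rw [weightMeasure_apply u measurableSet_Iio, inter_comm, Ioi_inter_Iio, weightPrimitive]

theorem alpha_eq {φ : ℝ≥0∞ ≃o ℝ≥0∞} {u : ℝ → ℝ≥0∞} (hu : MPos u) (r : ℝ≥0∞) {x : ℝ} (hx : 0 < x) :
    alpha φ u r x =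
      ∫⁻ y in Ioi x, nFunction φ.symm (r / weightMeasure u (Iio y)) ∂(weightMeasure u) := by
  rw [setLIntegral_weightMeasure hu measurableSet_Ioi
    (F := fun y => nFunction φ.symm (r / weightMeasure u (Iio y)))
    ((nFunction_mono φ.symm).measurable.comp
      (measurable_const.div (measurable_measure_Iio _))),
    inter_eq_left.2 (Ioi_subset_Ioi hx.le)]
  simp only [weightMeasure_Iio]
  rfl

theorem beta_eq {φ : ℝ≥0∞ ≃o ℝ≥0∞} {u : ℝ → ℝ≥0∞} (hu : MPos u) (r : ℝ≥0∞) {x : ℝ} (hx : 0 < x) :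
    beta φ u r x = ∫⁻ y in Ioi x, nFunction φ (r / ENNReal.ofReal y) ∂(weightMeasure u) := by
  rw [setLIntegral_weightMeasure hu measurableSet_Ioi
    (F := fun y => nFunction φ (r / ENNReal.ofReal y))
    ((nFunction_mono φ).measurable.comp
      (measurable_const.div ENNReal.measurable_ofReal)), inter_eq_left.2 (Ioi_subset_Ioi hx.le)]
  rfl

theorem AlphaCondition.exists_weightMeasure {φ : ℝ≥0∞ ≃o ℝ≥0∞} {u : ℝ → ℝ≥0∞}
    (h : AlphaCondition φ u) (hu : MPos u) :
    ∃ c : ℝ≥0∞, c ≠ 0 ∧ c ≠ ∞ ∧ ∀ r : ℝ≥0∞, r ≠ 0 → r ≠ ∞ → ∀ x : ℝ, 0 < x →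
      φ (c * (∫⁻ y in Ioi x, nFunction φ.symm (r / weightMeasure u (Iio y)) ∂(weightMeasure u)) / r)
        * weightMeasure u (Iio x) ≤ c⁻¹ * r := by
  obtain ⟨c, hc, h⟩ := h
  refine ⟨c, by simpa using hc.ne', ENNReal.coe_ne_top, fun r hr0 hr x hx => ?_⟩
  lift r to ℝ≥0 using hr
  rw [← alpha_eq hu _ hx, weightMeasure_Iio]
  exact h r x (pos_iff_ne_zero.2 (by simpa using hr0)) hx

theorem BetaCondition.exists_weightMeasure {φ : ℝ≥0∞ ≃o ℝ≥0∞} {u : ℝ → ℝ≥0∞}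
    (h : BetaCondition φ u) (hu : MPos u) :
    ∃ c : ℝ≥0∞, c ≠ 0 ∧ c ≠ ∞ ∧ ∀ r : ℝ≥0∞, r ≠ 0 → r ≠ ∞ → ∀ x : ℝ, 0 < x →
      ∫⁻ y in Iio x, φ.symm (c * (∫⁻ z in Ioi x, nFunction φ (r / ENNReal.ofReal z)
          ∂(weightMeasure u)) / r * (ENNReal.ofReal y / weightMeasure u (Iio y))) *
        (ENNReal.ofReal y / weightMeasure u (Iio y)) ∂(weightMeasure u) ≤ c⁻¹ * r := by
  obtain ⟨c, hc, h⟩ := h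
  refine ⟨c, by simpa using hc.ne', ENNReal.coe_ne_top, fun r hr0 hr x hx => ?_⟩
  lift r to ℝ≥0 using hr
  have hm : Measurable fun y => ENNReal.ofReal y / weightMeasure u (Iio y) :=
    ENNReal.measurable_ofReal.div (measurable_measure_Iio _)
  rw [← beta_eq hu _ hx, setLIntegral_weightMeasure hu measurableSet_Iio
    (F := fun y => φ.symm (c * beta φ u r x / r *
      (ENNReal.ofReal y / weightMeasure u (Iio y))) * (ENNReal.ofReal y / weightMeasure u (Iio y)))
    ((φ.symm.monotone.measurable.comp (hm.const_mul _)).mul hm), inter_comm, Ioi_inter_Iio]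
  refine le_trans (lintegral_mono fun y => le_of_eq ?_)
    (h r x (pos_iff_ne_zero.2 (by simpa using hr0)) hx)
  rw [weightMeasure_Iio, div_eq_mul_inv (ENNReal.ofReal y),
    div_eq_mul_inv (ENNReal.ofReal y * u y)]
  ring

/-- The modular inequality for the averaging operator on decreasing functions. -/
theorem exists_lintegral_average_le {φ : ℝ≥0∞ ≃o ℝ≥0∞} {u : ℝ → ℝ≥0∞} (hu : IsWeight u)
    (hα : AlphaCondition φ u) (hβ : BetaCondition φ u) :
    ∃ M : ℝ≥0, 0 < M ∧ ∀ g : ℝ → ℝ≥0∞, Antitone g →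
      ∫⁻ x, nFunction φ ((ENNReal.ofReal x)⁻¹ * ∫⁻ t in Ioo 0 x, g t) ∂(weightMeasure u) ≤
        ∫⁻ x, nFunction φ (M * g x) ∂(weightMeasure u) := by
  set ν := weightMeasure u with hν
  have h0 : ν (Iic 0) = 0 := weightMeasure_Iic_zero u
  by_cases hfin : ∀ x, ν (Iio x) ≠ ∞
  · by_cases hν0 : ν = 0
    · refine ⟨1, one_pos, fun g _ => ?_⟩
      simp [hν0]
    · have hα' := hα.exists_weightMeasure hu.mpos
      have hβ' := hβ.exists_weightMeasure hu.mpos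
      have hpos : ∀ x, 0 < x → ν (Iio x) ≠ 0 := by
        obtain ⟨c, hc0, -, hc⟩ := hβ'
        exact fun x hx => measure_Iio_ne_zero h0 hfin hν0 hc0 hc hx
      obtain ⟨D, hD, hDk⟩ := exists_lintegral_hardySum_le h0 hfin hpos hα' hβ'
      lift D to ℝ≥0 using hD
      refine ⟨16 * (8 * D + 2), by positivity, fun g hg => ?_⟩
      have := lintegral_nFunction_average_le h0 hfin hpos hDk hg
      exact_mod_cast this
  · push Not at hfin
    obtain ⟨b, hb⟩ := hfin
    -- Local integrability holds only away from 0, so U may be infinite. It is then infinite at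
    -- every t > 0, and the right side is infinite unless g vanishes on (0, ∞).
    have htop : ∀ t, 0 < t → ν (Iio t) = ∞ := by
      intro t ht
      by_contra h
      have h1 : ν (Iio b) ≤ ν (Iio t) + ν (Icc t b) := by
        refine le_trans (measure_mono fun y hy => ?_) (measure_union_le _ _)
        rcases lt_or_ge y t with h' | h'
        · exact Or.inl h'
        · exact Or.inr ⟨h', le_of_lt hy⟩
      have h2 : ν (Icc t b) < ∞ := by
        rw [hν, weightMeasure_apply u measurableSet_Icc]
        exact (lintegral_mono_set inter_subset_left).trans_lt (hu.locallyIntegrable t b ht)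
      rw [hb] at h1
      exact (ENNReal.add_lt_top.2 ⟨lt_top_iff_ne_top.2 h, h2⟩).not_ge h1
    refine ⟨1, one_pos, fun g hg => ?_⟩
    by_cases hg0 : ∃ t, 0 < t ∧ g t ≠ 0
    · obtain ⟨t, ht, hgt⟩ := hg0
      have : ∫⁻ x, nFunction φ ((1 : ℝ≥0) * g x) ∂ν = ∞ := by
        rw [← top_le_iff]
        calc ∞ = ∫⁻ _ in Iio t, nFunction φ (g t) ∂ν := by
              rw [setLIntegral_const, htop t ht, ENNReal.mul_top (nFunction_ne_zero φ hgt)]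
          _ ≤ ∫⁻ x in Iio t, nFunction φ ((1 : ℝ≥0) * g x) ∂ν :=
              setLIntegral_mono' measurableSet_Iio fun x hx => nFunction_mono φ (by
                rw [ENNReal.coe_one, one_mul]
                exact hg (le_of_lt hx))
          _ ≤ _ := setLIntegral_le_lintegral _ _
      rw [this]
      exact le_top
    · push Not at hg0
      have : ∀ x : ℝ, ∫⁻ t in Ioo 0 x, g t = 0 := fun x => by
        rw [setLIntegral_congr_fun (g := fun _ => 0) measurableSet_Ioo fun t ht => hg0 t ht.1]
        simp
      simp [this, nFunction_zero]

theorem gauge_le_of_average_le {φ : ℝ≥0∞ ≃o ℝ≥0∞} {u : ℝ → ℝ≥0∞} (hu : MPos u) {M : ℝ≥0}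
    (hM0 : 0 < M) (hM : ∀ g : ℝ → ℝ≥0∞, Antitone g →
      ∫⁻ x, nFunction φ ((ENNReal.ofReal x)⁻¹ * ∫⁻ t in Ioo 0 x, g t) ∂(weightMeasure u) ≤
        ∫⁻ x, nFunction φ (M * g x) ∂(weightMeasure u))
    {h g : ℝ → ℝ≥0∞} (hg : Antitone g)
    (hhg : ∀ x, 0 < x → h x ≤ (ENNReal.ofReal x)⁻¹ * ∫⁻ t in Ioo 0 x, g t) :
    gauge φ u h ≤ M * gauge φ u g := by
  have hM0' : (M : ℝ≥0∞) ≠ 0 := by simpa using hM0.ne'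
  rw [mul_comm, ← ENNReal.div_le_iff hM0' ENNReal.coe_ne_top]
  refine le_sInf fun r ⟨hr0, hr, hr1⟩ => ?_
  rw [ENNReal.div_le_iff hM0' ENNReal.coe_ne_top]
  have hrM0 : r * M ≠ 0 := mul_ne_zero hr0.ne' hM0'
  refine sInf_le ⟨pos_iff_ne_zero.2 hrM0, ENNReal.mul_lt_top hr ENNReal.coe_lt_top, ?_⟩
  have hgm : Measurable fun x => nFunction φ (g x / r) :=
    (nFunction_mono φ).measurable.comp (hg.measurable.div_const r)
  have hPm : Measurable fun x : ℝ => (ENNReal.ofReal x)⁻¹ * ∫⁻ t in Ioo 0 x, g t / (r * M) :=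
    ENNReal.measurable_ofReal.inv.mul (Monotone.measurable fun _ _ h =>
      lintegral_mono_set (Ioo_subset_Ioo le_rfl h))
  calc ∫⁻ x in Ioi 0, nFunction φ (h x / (r * M)) * u x
      ≤ ∫⁻ x in Ioi 0, nFunction φ ((ENNReal.ofReal x)⁻¹ *
          ∫⁻ t in Ioo 0 x, g t / (r * M)) * u x := by
        refine setLIntegral_mono' measurableSet_Ioi fun x hx =>
          mul_le_mul' (nFunction_mono φ ?_) le_rfl
        simp only [div_eq_mul_inv _ (r * M)]
        rw [lintegral_mul_const _ hg.measurable, ← mul_assoc]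
        exact mul_le_mul' (hhg x hx) le_rfl
    _ = ∫⁻ x, nFunction φ ((ENNReal.ofReal x)⁻¹ * ∫⁻ t in Ioo 0 x, g t / (r * M))
          ∂(weightMeasure u) :=
        (lintegral_weightMeasure hu ((nFunction_mono φ).measurable.comp hPm)).symm
    _ ≤ ∫⁻ x, nFunction φ (M * (g x / (r * M))) ∂(weightMeasure u) :=
        hM _ fun _ _ hxy => ENNReal.div_le_div_right (hg hxy) _
    _ = ∫⁻ x, nFunction φ (g x / r) ∂(weightMeasure u) := by
        refine lintegral_congr fun x => congrArg _ ?_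
        rw [div_eq_mul_inv, div_eq_mul_inv, ENNReal.mul_inv (Or.inl hr0.ne') (Or.inl hr.ne)]
        calc M * (g x * (r⁻¹ * (M : ℝ≥0∞)⁻¹)) = (M * (M : ℝ≥0∞)⁻¹) * (g x * r⁻¹) := by ring
          _ = _ := by rw [ENNReal.mul_inv_cancel hM0' ENNReal.coe_ne_top, one_mul]
    _ = ∫⁻ x in Ioi 0, nFunction φ (g x / r) * u x := lintegral_weightMeasure hu hgm
    _ ≤ 1 := hr1

end Weight

end OrliczLorentz

/-! ### Conclusion. -/

theorem theorem2p5
    (K : ℝ → ℝ → ℝ≥0∞) (hK : OrliczLorentz.MPos₂ K)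
    (φ₁ φ₂ : ℝ≥0∞ ≃o ℝ≥0∞)
    (u₁ u₂ : ℝ → ℝ≥0∞) (hu₁ : OrliczLorentz.IsWeight u₁) (hu₂ : OrliczLorentz.IsWeight u₂)
    (hα : OrliczLorentz.AlphaCondition φ₁ u₁) (hβ : OrliczLorentz.BetaCondition φ₁ u₁)
    (hL : ∃ C : ℝ≥0, 0 < C ∧ ∀ f : ℝ → ℝ≥0∞, OrliczLorentz.MPos f →
      OrliczLorentz.gauge φ₁ u₁
          (OrliczLorentz.integralOp (OrliczLorentz.iteratedRearr K) (OrliczLorentz.rearr f))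
        ≤ C * OrliczLorentz.gauge φ₂ u₂ (OrliczLorentz.rearr f)) :
    ∃ C : ℝ≥0, 0 < C ∧ ∀ f : ℝ → ℝ≥0∞, OrliczLorentz.MPos f →
      OrliczLorentz.gauge φ₁ u₁
          (OrliczLorentz.rearr (OrliczLorentz.integralOp K f))
        ≤ C * OrliczLorentz.gauge φ₂ u₂ (OrliczLorentz.rearr f) := by
  obtain ⟨C, hC, hL⟩ := hL
  obtain ⟨M, hM0, hM⟩ := OrliczLorentz.exists_lintegral_average_le hu₁ hα hβ
  refine ⟨M * C, mul_pos hM0 hC, fun f hf => ?_⟩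
  have hg : Antitone
      (OrliczLorentz.integralOp (OrliczLorentz.iteratedRearr K) (OrliczLorentz.rearr f)) :=
    OrliczLorentz.integralOp_antitone (fun _ => OrliczLorentz.rearr_antitone _) _
  refine (OrliczLorentz.gauge_le_of_average_le hu₁.mpos hM0 hM hg fun x hx =>
    OrliczLorentz.rearr_integralOp_le hK hf hx).trans ?_
  rw [ENNReal.coe_mul, mul_assoc]
  exact mul_le_mul' le_rfl (hL f hf)
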